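/- Work in ZFC. For a regular cardinal $\chi$ let $\mathcal H_\chi$ be the set of all sets whose transitive closure has cardinality less than $\chi$, regarded as the structure $(\mathcal H_\chi,\in)$. For a cardinal $\kappa$ and a set $M$, $[M]^{\kappa}$ denotes the set of subsets of $M$ of cardinality exactly $\kappa$, ordered by inclusion. Let $\mathcal M_\chi$ be the set of all elementary submodels $M\prec\mathcal H_\chi$ such that $|M|=\aleph_1$ and $[M]^{\aleph_0}\cap M$ is cofinal in $[M]^{\aleph_0}$. For a subalgebra $A$ of a Boolean algebra $B$, write $A\leq_{sep}B$ if for every $b\in B$ and every uncountable $T\subseteq\{a\in A:a\leq b\}$ there is $a\in A$ with $a\leq b$ such that $\{c\in T:c\leq a\}$ is uncountable. $\operatorname{SEP}(\mathcal P(\omega))$ is the statement: for all sufficiently large regular $\chi$, every $Y\in[\mathcal H_\chi]^{\aleph_1}$ is contained in some $M\in\mathcal M_\chi$ with $\mathcal P(\omega)\cap M\leq_{sep}\mathcal P(\omega)$. For a partial order $P$ and $Q\subseteq P$, write $Q\leq_{\aleph_2}P$ if for every $p\in P$ the set $\{q\in Q:q\leq p\}$ has a cofinal subset of cardinality $<\aleph_2$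 and the set $\{q\in Q:q\geq p\}$ has a coinitial subset of cardinality $<\aleph_2$. A partial order $(P,\leq)$ has the $\aleph_2$-IDP if for all sufficiently large regular $\chi$ and all $M\prec\mathcal H_\chi$ with $|M|=\aleph_2$ and $(P,\leq)\in M$ such that $[M]^{\aleph_1}\cap M$ is cofinal in $[M]^{\aleph_1}$, one has $P\cap M\leq_{\aleph_2}P$. $\Box_{\omega_1}$ is the statement that there is a sequence $(C_\alpha)$, indexed by the limit ordinals $\alpha<\omega_2$, such that each $C_\alpha$ is a closed unbounded subset of $\alpha$ of order type at most $\omega_1$, and $C_\beta=C_\alpha\cap\beta$ whenever $\beta<\alpha$ is a limit point of $C_\alpha$. The cardinal $\mathfrak a$ is the least cardinality of an infinite maximal almost disjoint family of infinite subsets of $\omega$. **Corollary 8.16.** (i) If $2^{\aleph_0}=\aleph_2$, then the partial order $(\mathcal P(\omega),\subseteq)$ has the $\aleph_2$-IDP. (ii) Suppose that $\Box_{\omega_1}$ holds and that $(\mathcal P(\omega),\subseteq)$ has the $\aleph_2$-IDP. Then $\operatorname{SEP}(\mathcal P(\omega))$ implies $\mathfrak a=\aleph_1$. -/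

import Mathlib

open Cardinal Ordinal Set Filter

universe u

namespace SepIDP

/-! ### The structures `(H_χ, ∈)` and their elementary submodels

The set-theoretic universe is `ZFSet.{u}`. -/

/-- The only non-logical symbol of the language of set theory: a binary relation. -/
inductive MemRel : ℕ → Type
  | mem : MemRel 2

/-- The first-order language `{∈}` of set theory (equality is a logical symbol). -/
def setLang : FirstOrder.Language := ⟨fun _ => Empty, MemRel⟩

/-- The elements of the transitive closure of `x`. -/
def trcl (x : ZFSet.{u}) : Set ZFSet.{u} := {y | Relation.TransGen (· ∈ ·) y x}

/-- `H_χ`, the collection of all sets whose transitive closure has fewer than `χ` elements. -/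
def H (χ : Cardinal.{u}) : Set ZFSet.{u} := {x | #(trcl x) < Cardinal.lift.{u + 1} χ}

/-- `H_χ` as a first-order structure `(H_χ, ∈)`. -/
instance structureH (χ : Cardinal.{u}) : setLang.Structure (H χ) where
  funMap := fun f => nomatch f
  RelMap := fun r => match r with
    | .mem => fun v => (v 0 : ZFSet.{u}) ∈ (v 1 : ZFSet.{u})

/-- `M` is (the underlying set of) an elementary submodel of `(H_χ, ∈)`. -/
def IsElemSubmodel (χ : Cardinal.{u}) (M : Set ZFSet.{u}) : Prop :=
  ∃ N : setLang.ElementarySubstructure (H χ), M = Subtype.val '' (N : Set (H χ))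

/-- `[M]^κ ∩ M` is cofinal in `[M]^κ`. -/
def InternallyCofinal (κ : Cardinal.{u + 1}) (M : Set ZFSet.{u}) : Prop :=
  ∀ X : Set ZFSet.{u}, X ⊆ M → #X = κ →
    ∃ y ∈ M, (y : Set ZFSet.{u}) ⊆ M ∧ #(y : Set ZFSet.{u}) = κ ∧ X ⊆ (y : Set ZFSet.{u})

/-- The set of all `M ≺ H_χ` with `|M| = ℵ₁` such that `[M]^ℵ₀ ∩ M` is cofinal in `[M]^ℵ₀`. -/
def goodModels (χ : Cardinal.{u}) : Set (Set ZFSet.{u}) :=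
  {M | IsElemSubmodel χ M ∧ #M = ℵ_ 1 ∧ InternallyCofinal ℵ₀ M}

/-! ### `SEP` for power set algebras -/

/-- `A` is (the underlying set of) a subalgebra of the Boolean algebra `𝒫(X)`. -/
structure IsSubalgebra (X : ZFSet.{u}) (A : Set ZFSet.{u}) : Prop where
  subset : ∀ a ∈ A, a ⊆ X
  empty_mem : ∅ ∈ A
  union_mem : ∀ a ∈ A, ∀ b ∈ A, a ∪ b ∈ A
  compl_mem : ∀ a ∈ A, X \ a ∈ A

/-- `A ≤_sep 𝒫(X)`: `A` is a subalgebra of `𝒫(X)`, and for every `b ∈ 𝒫(X)` and every uncountable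
`T ⊆ A ↾ b` there is `a ∈ A ↾ b` such that `{c ∈ T : c ≤ a}` is uncountable. -/
def LeSep (X : ZFSet.{u}) (A : Set ZFSet.{u}) : Prop :=
  IsSubalgebra X A ∧
    ∀ b : ZFSet.{u}, b ⊆ X →
      ∀ T : Set ZFSet.{u}, T ⊆ {a | a ∈ A ∧ a ⊆ b} → ¬ T.Countable →
        ∃ a ∈ A, a ⊆ b ∧ ¬ {c | c ∈ T ∧ c ⊆ a}.Countable

/-- `SEP(𝒫(X))`: for all sufficiently large regular `χ`, there are cofinally many (in
`[H_χ]^ℵ₁`) good models `M` such that `𝒫(X) ∩ M ≤_sep 𝒫(X)`. -/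
def SEPPowerset (X : ZFSet.{u}) : Prop :=
  ∃ χ₀ : Cardinal.{u}, ∀ χ : Cardinal.{u}, χ₀ ≤ χ → χ.IsRegular →
    ∀ Y : Set ZFSet.{u}, Y ⊆ H χ → #Y = ℵ_ 1 →
      ∃ M ∈ goodModels χ, Y ⊆ M ∧ LeSep X ((X.powerset : Set ZFSet.{u}) ∩ M)

/-! ### The `ℵ₂`-ideal property of a partial order -/

/-- For `Q ⊆ P`, where `P` is ordered by `le`: for all `p ∈ P`, the set `{q ∈ Q : q ≤ p}` has a
cofinal subset of size `< κ` and the set `{q ∈ Q : p ≤ q}` has a coinitial subset of size `< κ`.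
(For `κ = ℵ₁` this is the relation `Q ≤_σ P`.) -/
def LeCard (κ : Cardinal.{u + 1}) (le : ZFSet.{u} → ZFSet.{u} → Prop) (Q P : Set ZFSet.{u}) :
    Prop :=
  Q ⊆ P ∧ ∀ p ∈ P,
    (∃ C : Set ZFSet.{u}, C ⊆ {q | q ∈ Q ∧ le q p} ∧ #C < κ ∧
      ∀ q ∈ Q, le q p → ∃ c ∈ C, le q c) ∧
    (∃ C : Set ZFSet.{u}, C ⊆ {q | q ∈ Q ∧ le p q} ∧ #C < κ ∧
      ∀ q ∈ Q, le p q → ∃ c ∈ C, le c q)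

/-- The `ℵ₂`-IDP for the partial order `(P, R)`, where `R` is a set of ordered pairs: for all
sufficiently large regular `χ` and all `M ≺ H_χ` with `|M| = ℵ₂` and `(P, R) ∈ M`, if
`[M]^ℵ₁ ∩ M` is cofinal in `[M]^ℵ₁` then `P ∩ M ≤_{ℵ₂} P`. -/
def AlephTwoIDP (P R : ZFSet.{u}) : Prop :=
  ∃ χ₀ : Cardinal.{u}, ∀ χ : Cardinal.{u}, χ₀ ≤ χ → χ.IsRegular →
    ∀ M : Set ZFSet.{u}, IsElemSubmodel χ M → #M = ℵ_ 2 → ZFSet.pair P R ∈ M →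
      InternallyCofinal (ℵ_ 1) M →
        LeCard (ℵ_ 2) (fun p q => ZFSet.pair p q ∈ R)
          ((P : Set ZFSet.{u}) ∩ M) (P : Set ZFSet.{u})

/-- The inclusion relation on `P`, as a set of ordered pairs. -/
def inclusionRel (P : ZFSet.{u}) : ZFSet.{u} := ZFSet.pairSep (fun p q => p ⊆ q) P P

/-! ### Jensen's square principle at `ω₁` -/

/-- `(C α)`, for `α < ω₂` a limit ordinal, is a `□_{ω₁}`-sequence: each `C α` is a club subset of
`α` of order type at most `ω₁`, and `C β = C α ∩ β` for every limit point `β < α` of `C α`. -/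
structure IsSquareSeq (C : Ordinal.{u} → Set Ordinal.{u}) : Prop where
  subset : ∀ α < ω_ 2, Order.IsSuccLimit α → C α ⊆ Iio α
  unbounded : ∀ α < ω_ 2, Order.IsSuccLimit α → ∀ β < α, ∃ γ ∈ C α, β < γ
  closed : ∀ α < ω_ 2, Order.IsSuccLimit α → ∀ β < α, AccPt β (𝓟 (C α)) → β ∈ C α
  type_le : ∀ α < ω_ 2, Order.IsSuccLimit α → typeLT (C α) ≤ ω_ 1
  coherent : ∀ α < ω_ 2, Order.IsSuccLimit α → ∀ β < α, AccPt β (𝓟 (C α)) → C β = C α ∩ Iio β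

/-- The principle `□_{ω₁}`. -/
def SquareOmegaOne : Prop := ∃ C : Ordinal.{u} → Set Ordinal.{u}, IsSquareSeq C

/-! ### The almost disjointness number -/

/-- `A` is an infinite maximal almost disjoint family of infinite subsets of `ω`. -/
structure IsMAD (A : Set (Set ℕ)) : Prop where
  infinite : A.Infinite
  infinite_mem : ∀ a ∈ A, a.Infinite
  almostDisjoint : ∀ a ∈ A, ∀ b ∈ A, a ≠ b → (a ∩ b).Finite
  maximal : ∀ b : Set ℕ, b.Infinite → ∃ a ∈ A, (a ∩ b).Infinite

/-- The cardinal `𝔞`, the least size of an infinite MAD family. -/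
noncomputable def almostDisjointnessNumber : Cardinal.{0} :=
  sInf {κ | ∃ A : Set (Set ℕ), IsMAD A ∧ #A = κ}

end SepIDP

/-! (i) If `2^ℵ₀ = ℵ₂`, an internally cofinal `M` of size `ℵ₂` that contains `𝒫(ω)` as an element
contains all of its elements. Well-order `𝒫(ω)` in type `ω₂` by a relation in `M`: the trace of `M`
is an initial segment, and it cannot be a proper one, for then it would have size at most `ℵ₁`, be
covered by a set of size `ℵ₁` in `M`, and so be strictly bounded by one of its own members. Hence
`𝒫(ω) ∩ M = 𝒫(ω)` and every `{p}` is a witness (`IsElemSubmodel.subset_of_mk_eq_aleph_two`).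

(ii) Using SEP, build an increasing tower of models `K ζ`, `ζ < ω₂`, together with sets `A ζ ⊆ ℕ`.
When `C ζ` is countable, `A ζ` is almost disjoint from fixed columns and from `A γ` for all limit
points `γ` of `C ζ`, and it meets, in an infinite set, each of countably many prescribed sets that
is positive for the ideal generated by these. The prescribed sets are read off along `C ζ` from
enumerations of the earlier models.

The union of the tower has size `ℵ₂` and is internally cofinal, so the `ℵ₂`-IDP assigns to each `s`
a stage `f s < ω₂` whose model interpolates between `s` and every subset of `s` in the union
(`IsTower.exists_interpolation`). SEP then gives a model `M` closed under `f` and under tails of the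
`A β`, whose trace on `ω₂` is some `δ` of uncountable cofinality (`SEPAt.exists_closed_model`).

The columns and the `A β`, for `β` a limit point of `C δ`, form a MAD family of size at most `ℵ₁`
(`IsTower.isMAD`). Coherence of the square gives almost disjointness. For maximality, let `x` be
almost disjoint from the family. Then `xᶜ` contains tails of uncountably many `A β`; SEP for `M`,
interpolation, and SEP for one `K ζ` with `ζ < δ` shrink `xᶜ` to some `a' ∈ K ζ` that still contains
uncountably many of these tails. The complement of `a'` was prescribed at one of these `β`, is
positive since it contains `x`, and yet meets `A β` in a finite set. -/

namespace SepIDP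

/-! ### Set-theoretic formulas with named variables -/

/-- The membership symbol. -/
def memSymbol : setLang.Relations 2 := MemRel.mem

/-- Formulas of set theory with named variables. -/
inductive Fml : Type
  | mem (i j : ℕ) : Fml
  | eq (i j : ℕ) : Fml
  | neg (φ : Fml) : Fml
  | and (φ ψ : Fml) : Fml
  | ex (i : ℕ) (φ : Fml) : Fml

namespace Fml

/-- Implication. -/
def imp (φ ψ : Fml) : Fml := neg (and φ (neg ψ))

/-- Disjunction. -/
def or (φ ψ : Fml) : Fml := neg (and (neg φ) (neg ψ))

/-- Equivalence. -/
def iff (φ ψ : Fml) : Fml := and (imp φ ψ) (imp ψ φ)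

/-- Universal quantification. -/
def all (i : ℕ) (φ : Fml) : Fml := neg (ex i (neg φ))

/-- Satisfaction in `H χ`. -/
def Sat {χ : Cardinal.{u}} : Fml → (ℕ → H χ) → Prop
  | mem i j, v => (v i : ZFSet.{u}) ∈ (v j : ZFSet.{u})
  | eq i j, v => v i = v j
  | neg φ, v => ¬ Sat φ v
  | and φ ψ, v => Sat φ v ∧ Sat ψ v
  | ex i φ, v => ∃ x, Sat φ (Function.update v i x)

variable {χ : Cardinal.{u}} {v : ℕ → H χ} {φ ψ : Fml} {i j : ℕ}

@[simp] theorem sat_mem : (mem i j).Sat v ↔ (v i : ZFSet.{u}) ∈ (v j : ZFSet.{u}) := Iff.rfl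
@[simp] theorem sat_eq : (eq i j).Sat v ↔ v i = v j := Iff.rfl
@[simp] theorem sat_neg : (neg φ).Sat v ↔ ¬ φ.Sat v := Iff.rfl
@[simp] theorem sat_and : (and φ ψ).Sat v ↔ φ.Sat v ∧ ψ.Sat v := Iff.rfl
@[simp] theorem sat_ex : (ex i φ).Sat v ↔ ∃ x, φ.Sat (Function.update v i x) := Iff.rfl
@[simp] theorem sat_imp : (imp φ ψ).Sat v ↔ (φ.Sat v → ψ.Sat v) := by simp [imp]
@[simp] theorem sat_or : (or φ ψ).Sat v ↔ (φ.Sat v ∨ ψ.Sat v) := by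
  simp only [or, sat_neg, sat_and]; tauto
@[simp] theorem sat_iff : (iff φ ψ).Sat v ↔ (φ.Sat v ↔ ψ.Sat v) := by
  simp only [iff, sat_and, sat_imp]; tauto
@[simp] theorem sat_all : (all i φ).Sat v ↔ ∀ x, φ.Sat (Function.update v i x) := by
  simp [all]

/-- Links `Fml`, in which concrete formulas are convenient to write and evaluate, to the first-order
formulas that elementary substructures preserve. Quantifying variable `i` amounts to relabelling `i`
as the single variable of an existential block. -/
theorem exists_formula (χ : Cardinal.{u}) (φ : Fml) :
    ∃ ψ : setLang.Formula ℕ, ∀ v : ℕ → H χ, ψ.Realize v ↔ φ.Sat v := by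
  induction φ with
  | mem i j =>
    refine ⟨FirstOrder.Language.Relations.formula₂ memSymbol
      (FirstOrder.Language.Term.var i) (FirstOrder.Language.Term.var j), fun v => ?_⟩
    rw [FirstOrder.Language.Formula.realize_rel₂]
    rfl
  | eq i j =>
    refine ⟨(FirstOrder.Language.Term.var i).equal (FirstOrder.Language.Term.var j), fun v => ?_⟩
    simp
  | neg φ ih =>
    obtain ⟨ψ, h⟩ := ih
    exact ⟨ψ.not, fun v => by simp [h]⟩
  | and φ φ' ih ih' =>
    obtain ⟨ψ, h⟩ := ih
    obtain ⟨ψ', h'⟩ := ih'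
    exact ⟨ψ ⊓ ψ', fun v => by simp [h, h']⟩
  | ex i φ ih =>
    obtain ⟨ψ, h⟩ := ih
    refine ⟨FirstOrder.Language.Formula.iExs Unit
      (FirstOrder.Language.Formula.relabel
        (fun k => if k = i then Sum.inr () else Sum.inl k) ψ), fun v => ?_⟩
    rw [FirstOrder.Language.Formula.realize_iExs]
    simp only [FirstOrder.Language.Formula.realize_relabel, h, sat_ex]
    have key : ∀ f : Unit → H χ,
        (fun a => Sum.elim v f a) ∘ (fun k => if k = i then Sum.inr () else Sum.inl k) =
          Function.update v i (f ()) := by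
      intro f
      funext k
      by_cases hk : k = i <;> simp [hk, Function.update]
    constructor
    · rintro ⟨f, hf⟩
      exact ⟨f (), by rwa [← key]⟩
    · rintro ⟨x, hx⟩
      exact ⟨fun _ => x, by rwa [key]⟩

end Fml

/-! ### Reflection into elementary submodels and directed unions -/

variable {χ : Cardinal.{u}} {M : Set ZFSet.{u}}

theorem IsElemSubmodel.subset_H (hM : IsElemSubmodel χ M) : M ⊆ H χ := by
  obtain ⟨N, rfl⟩ := hM
  rintro _ ⟨x, -, rfl⟩
  exact x.2

/-- The Tarski–Vaught property of elementary submodels. -/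
theorem IsElemSubmodel.exists_mem (hM : IsElemSubmodel χ M) (φ : Fml) (i : ℕ) (v : ℕ → H χ)
    (hv : ∀ j, (v j : ZFSet.{u}) ∈ M) (h : ∃ x, φ.Sat (Function.update v i x)) :
    ∃ x : H χ, (x : ZFSet.{u}) ∈ M ∧ φ.Sat (Function.update v i x) := by
  obtain ⟨N, rfl⟩ := hM
  have hv' : ∀ j, v j ∈ N := fun j => by
    obtain ⟨x, hx, hxj⟩ := hv j
    rwa [← Subtype.ext hxj]
  let w : ℕ → N := fun j => ⟨v j, hv' j⟩
  obtain ⟨ψ, hψ⟩ := Fml.exists_formula χ φ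
  let θ : setLang.Formula ℕ := FirstOrder.Language.Formula.iExs Unit
      (FirstOrder.Language.Formula.relabel
        (fun k => if k = i then Sum.inr () else Sum.inl k) ψ)
  have key : ∀ {K : Type (u + 1)} (v : ℕ → K) (f : Unit → K),
        (fun a => Sum.elim v f a) ∘ (fun k => if k = i then Sum.inr () else Sum.inl k) =
          Function.update v i (f ()) := by
    intro K v f
    funext k
    by_cases hk : k = i <;> simp [hk, Function.update]
  have h1 : θ.Realize v := by
    rw [FirstOrder.Language.Formula.realize_iExs]
    obtain ⟨x, hx⟩ := h
    refine ⟨fun _ => x, ?_⟩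
    rw [FirstOrder.Language.Formula.realize_relabel, key, hψ]
    exact hx
  have h2 : θ.Realize w := by
    rw [← N.subtype.map_formula θ w]
    exact h1
  rw [FirstOrder.Language.Formula.realize_iExs] at h2
  obtain ⟨f, hf⟩ := h2
  rw [FirstOrder.Language.Formula.realize_relabel, key,
    ← N.subtype.map_formula, hψ] at hf
  refine ⟨f (), ⟨f (), (f ()).2, rfl⟩, ?_⟩
  convert hf using 1
  funext k
  by_cases hk : k = i
  · subst hk; simp
  · simp [hk, w]

/-- The union of a directed family of elementary submodels is an elementary submodel. -/
theorem isElemSubmodel_iUnion {ι : Type*} [Nonempty ι] (K : ι → Set ZFSet.{u})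
    (hK : ∀ i, IsElemSubmodel χ (K i)) (hdir : Directed (· ⊆ ·) K) :
    IsElemSubmodel χ (⋃ i, K i) := by
  choose N hN using hK
  let S : setLang.Substructure (H χ) :=
    { carrier := ⋃ i, (N i : Set (H χ))
      fun_mem := fun f => nomatch f }
  have hS : S.IsElementary := by
    refine S.isElementary_of_exists fun n φ x a ha => ?_
    have hx : ∀ j, ∃ i, (x j : H χ) ∈ N i := fun j => mem_iUnion.1 (x j).2
    choose g hg using hx
    -- A formula has finitely many parameters, so by directedness a single model of the family
    -- contains them all and already supplies a witness.
    obtain ⟨i, hi⟩ : ∃ i, ∀ j, K (g j) ⊆ K i := by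
      obtain ⟨i, hi⟩ := hdir.finite_le g
      exact ⟨i, hi⟩
    have hx' : ∀ j, (x j : H χ) ∈ N i := fun j => by
      have := hi j (by rw [hN]; exact ⟨_, hg j, rfl⟩)
      rw [hN] at this
      obtain ⟨y, hy, hyx⟩ := this
      rwa [← Subtype.ext hyx]
    let x' : Fin n → N i := fun j => ⟨x j, hx' j⟩
    have h1 : φ.ex.Realize default (fun j => (N i).subtype (x' j)) := by
      rw [FirstOrder.Language.BoundedFormula.realize_ex]
      exact ⟨a, ha⟩
    have h2 : φ.ex.Realize default x' := by
      rw [← (N i).subtype.map_boundedFormula φ.ex default x']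
      rw [Subsingleton.elim (_ ∘ default) default]
      exact h1
    rw [FirstOrder.Language.BoundedFormula.realize_ex] at h2
    obtain ⟨b, hb⟩ := h2
    rw [← (N i).subtype.map_boundedFormula] at hb
    refine ⟨⟨b, mem_iUnion.2 ⟨i, b.2⟩⟩, ?_⟩
    convert hb using 1
    rw [Fin.comp_snoc]
    rfl
  refine ⟨⟨S, hS⟩, ?_⟩
  ext z
  constructor
  · intro hz
    obtain ⟨i, hi⟩ := mem_iUnion.1 hz
    rw [hN] at hi
    obtain ⟨y, hy, rfl⟩ := hi
    exact ⟨y, mem_iUnion.2 ⟨i, hy⟩, rfl⟩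
  · rintro ⟨y, hy, rfl⟩
    obtain ⟨i, hi⟩ := mem_iUnion.1 hy
    exact mem_iUnion.2 ⟨i, by rw [hN]; exact ⟨y, hi, rfl⟩⟩

end SepIDP

namespace SepIDP

/-! ### Closure properties of `H χ` -/

variable {χ : Cardinal.{u}} {x y z : ZFSet.{u}}

theorem trcl_subset_of_mem (h : y ∈ x) : trcl y ⊆ trcl x := fun _ hz => hz.tail h

theorem mem_H_of_mem (h : y ∈ x) (hx : x ∈ H χ) : y ∈ H χ :=
  (mk_le_mk_of_subset (trcl_subset_of_mem h)).trans_lt hx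

theorem trcl_eq (x : ZFSet.{u}) : trcl x = ⋃ y : (x : Set ZFSet.{u}), insert y.1 (trcl y.1) := by
  ext z
  simp only [mem_iUnion, mem_insert_iff]
  constructor
  · intro hz
    induction hz using Relation.TransGen.head_induction_on with
    | single h => exact ⟨⟨_, h⟩, Or.inl rfl⟩
    | head h1 _ ih =>
      obtain ⟨y, hy | hy⟩ := ih
      · exact ⟨y, Or.inr (Relation.TransGen.single (hy ▸ h1))⟩
      · exact ⟨y, Or.inr (hy.head h1)⟩
  · rintro ⟨y, rfl | hy⟩
    · exact Relation.TransGen.single y.2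
    · exact Relation.TransGen.tail hy y.2

theorem mem_H_of_forall (hχ : χ.IsRegular) (hx : ∀ y ∈ x, y ∈ H χ)
    (hc : #(x : Set ZFSet.{u}) < lift.{u + 1} χ) : x ∈ H χ := by
  have hreg : (lift.{u + 1} χ).IsRegular := hχ.lift
  change #(trcl x) < _
  rw [trcl_eq, card_iUnion_lt_iff_forall_of_isRegular hreg hc]
  intro y
  exact mk_insert_le.trans_lt (add_lt_of_lt hreg.1 (hx y y.2)
    (one_lt_aleph0.trans_le hreg.1))

theorem mem_H_of_subset (h : y ⊆ x) (hx : x ∈ H χ) : y ∈ H χ := by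
  refine (mk_le_mk_of_subset ?_).trans_lt hx
  rw [trcl_eq, trcl_eq]
  refine iUnion_subset fun a => ?_
  exact subset_iUnion (fun y : (x : Set ZFSet.{u}) => insert y.1 (trcl y.1)) ⟨a.1, h a.2⟩

theorem mk_lt_of_mem_H (hx : x ∈ H χ) : #(x : Set ZFSet.{u}) < lift.{u + 1} χ :=
  (mk_le_mk_of_subset fun _ hy => Relation.TransGen.single hy).trans_lt hx

theorem pair_elem_H (hχ : χ.IsRegular) (hx : x ∈ H χ) (hy : y ∈ H χ) :
    ({x, y} : ZFSet.{u}) ∈ H χ := by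
  refine mem_H_of_forall hχ (fun z hz => ?_) ?_
  · rcases ZFSet.mem_pair.1 hz with rfl | rfl <;> assumption
  · have hreg : (lift.{u + 1} χ).IsRegular := hχ.lift
    have h : (({x, y} : ZFSet.{u}) : Set ZFSet.{u}) = {x, y} := by ext; simp
    rw [h]
    exact ((Set.toFinite _).lt_aleph0).trans_le hreg.1

theorem singleton_mem_H (hχ : χ.IsRegular) (hx : x ∈ H χ) : ({x} : ZFSet.{u}) ∈ H χ := by
  have := pair_elem_H hχ hx hx
  rwa [ZFSet.pair_eq_singleton] at this

theorem pair_mem_H (hχ : χ.IsRegular) (hx : x ∈ H χ) (hy : y ∈ H χ) : ZFSet.pair x y ∈ H χ :=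
  pair_elem_H hχ (singleton_mem_H hχ hx) (pair_elem_H hχ hx hy)

theorem range_mem_H {ι : Type*} [Small.{u} ι] (hχ : χ.IsRegular) {f : ι → ZFSet.{u}}
    (hf : ∀ i, f i ∈ H χ) (hι : #(Set.range f) < lift.{u + 1} χ) : ZFSet.range f ∈ H χ := by
  refine mem_H_of_forall hχ (fun y hy => ?_) ?_
  · obtain ⟨i, rfl⟩ := ZFSet.mem_range.1 hy
    exact hf i
  · rwa [ZFSet.coe_range]

theorem toZFSet_mem_H (hχ : χ.IsRegular) {o : Ordinal.{u}} (ho : o.card < χ) :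
    o.toZFSet ∈ H χ := by
  induction o using WellFoundedLT.induction with
  | ind o ih =>
    refine mem_H_of_forall hχ (fun y hy => ?_) ?_
    · obtain ⟨a, ha, rfl⟩ := Ordinal.mem_toZFSet_iff.1 hy
      exact ih a ha ((Ordinal.card_le_card ha.le).trans_lt ho)
    · have := ZFSet.cardinalMk_coe_sort (x := o.toZFSet)
      rw [Ordinal.card_toZFSet] at this
      exact this.trans_lt (lift_lt.{u, u + 1}.2 ho)

/-- The `ZFSet` whose elements are those of a small collection. -/
noncomputable def toZF (K : Set ZFSet.{u}) : ZFSet.{u} :=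
  open Classical in
  -- The value `∅` is junk: the lemmas about `toZF` assume a cardinality bound that makes `K` small.
  if _ : Small.{u} K then ZFSet.range (Subtype.val : K → ZFSet.{u}) else ∅

theorem small_of_mk_le {α : Type (u + 1)} {c : Cardinal.{u}} (h : #α ≤ lift.{u + 1} c) :
    Small.{u} α := by
  obtain ⟨d, hd⟩ := mem_range_lift_of_le h
  induction d using Cardinal.inductionOn with
  | mk β =>
    rw [← Cardinal.mk_uLift] at hd
    obtain ⟨e⟩ := Cardinal.eq.1 hd
    exact ⟨β, ⟨e.symm.trans Equiv.ulift⟩⟩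

theorem coe_toZF {K : Set ZFSet.{u}} {c : Cardinal.{u}} (h : #K ≤ lift.{u + 1} c) :
    (toZF K : Set ZFSet.{u}) = K := by
  have := small_of_mk_le h
  rw [toZF, dif_pos this, ZFSet.coe_range, Subtype.range_val]

theorem mem_toZF {K : Set ZFSet.{u}} {c : Cardinal.{u}} (h : #K ≤ lift.{u + 1} c) :
    x ∈ toZF K ↔ x ∈ K := by
  conv_rhs => rw [← coe_toZF h]
  rfl

theorem toZF_mem_H (hχ : χ.IsRegular) {K : Set ZFSet.{u}} (hK : K ⊆ H χ)
    (hc : #K < lift.{u + 1} χ) : toZF K ∈ H χ := by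
  refine mem_H_of_forall hχ (fun y hy => hK ((mem_toZF hc.le).1 hy)) ?_
  rwa [coe_toZF hc.le]

/-! ### The power set of `ω` -/

/-- The natural numbers as elements of `ω`. -/
noncomputable def natCode (n : ℕ) : ZFSet.{u} := (n : Ordinal.{u}).toZFSet

theorem natCode_injective : Function.Injective natCode.{u} := fun m n h => by
  simpa using Ordinal.toZFSet_injective h

theorem natCode_eq_mk (n : ℕ) : natCode.{u} n = ZFSet.mk (PSet.ofNat n) := by
  induction n with
  | zero => simp [natCode, PSet.ofNat]; rfl
  | succ n ih =>
    rw [natCode, Nat.cast_succ, Ordinal.toZFSet_add_one]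
    change insert (natCode n) (natCode n) = _
    rw [ih]
    rfl

theorem mem_omega_iff : x ∈ ZFSet.omega.{u} ↔ ∃ n : ℕ, natCode n = x := by
  simp only [natCode_eq_mk]
  induction x using Quotient.inductionOn with
  | h a =>
    constructor
    · rintro ⟨n, hn⟩
      exact ⟨n.down, (Quotient.sound hn).symm⟩
    · rintro ⟨n, hn⟩
      exact ⟨⟨n⟩, (Quotient.exact hn).symm⟩

/-- Sets of natural numbers as subsets of `ω`. -/
noncomputable def setCode (s : Set ℕ) : ZFSet.{u} := ZFSet.range fun n : s => natCode n.1

theorem natCode_mem_setCode {n : ℕ} {s : Set ℕ} : natCode.{u} n ∈ setCode s ↔ n ∈ s := by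
  simp only [setCode, ZFSet.mem_range]
  constructor
  · rintro ⟨m, hm⟩
    rw [← natCode_injective hm]
    exact m.2
  · exact fun h => ⟨⟨n, h⟩, rfl⟩

theorem setCode_subset_omega (s : Set ℕ) : setCode.{u} s ⊆ ZFSet.omega := fun z hz => by
  obtain ⟨n, rfl⟩ := ZFSet.mem_range.1 hz
  exact mem_omega_iff.2 ⟨n, rfl⟩

theorem setCode_subset_iff {s t : Set ℕ} : setCode.{u} s ⊆ setCode t ↔ s ⊆ t := by
  constructor
  · exact fun h n hn => natCode_mem_setCode.1 (h (natCode_mem_setCode.2 hn))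
  · intro h z hz
    obtain ⟨n, rfl⟩ := mem_omega_iff.1 (setCode_subset_omega s hz)
    exact natCode_mem_setCode.2 (h (natCode_mem_setCode.1 hz))

theorem setCode_injective : Function.Injective setCode.{u} := fun _ _ h =>
  (setCode_subset_iff.1 (h ▸ subset_rfl)).antisymm (setCode_subset_iff.1 (h ▸ subset_rfl))

theorem exists_setCode (h : x ⊆ ZFSet.omega) : ∃ s : Set ℕ, setCode s = x := by
  refine ⟨{n | natCode n ∈ x}, ?_⟩
  ext z
  constructor
  · intro hz
    obtain ⟨n, rfl⟩ := mem_omega_iff.1 (setCode_subset_omega _ hz)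
    exact natCode_mem_setCode.1 hz
  · intro hz
    obtain ⟨n, rfl⟩ := mem_omega_iff.1 (h hz)
    exact natCode_mem_setCode.2 hz

theorem setCode_mem_powerset (s : Set ℕ) : setCode.{u} s ∈ ZFSet.omega.powerset :=
  ZFSet.mem_powerset.2 (setCode_subset_omega s)

theorem mem_powerset_omega_iff : x ∈ ZFSet.omega.powerset ↔ ∃ s : Set ℕ, setCode s = x :=
  ⟨fun h => exists_setCode (ZFSet.mem_powerset.1 h), by rintro ⟨s, rfl⟩; exact setCode_mem_powerset s⟩

theorem omega_sdiff_setCode (s : Set ℕ) : ZFSet.omega.{u} \ setCode s = setCode sᶜ := by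
  ext z
  rw [ZFSet.mem_sdiff]
  constructor
  · rintro ⟨h1, h2⟩
    obtain ⟨n, rfl⟩ := mem_omega_iff.1 h1
    rw [natCode_mem_setCode] at h2 ⊢
    exact h2
  · intro hz
    obtain ⟨n, rfl⟩ := mem_omega_iff.1 (setCode_subset_omega _ hz)
    rw [natCode_mem_setCode] at hz ⊢
    exact ⟨mem_omega_iff.2 ⟨n, rfl⟩, hz⟩

theorem coe_powerset_omega :
    ((ZFSet.omega.{u}.powerset : ZFSet.{u}) : Set ZFSet.{u}) = Set.range setCode := by
  ext z
  exact mem_powerset_omega_iff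

theorem mk_powerset_omega :
    #((ZFSet.omega.{u}.powerset : ZFSet.{u}) : Set ZFSet.{u}) = 2 ^ (ℵ₀ : Cardinal.{u + 1}) := by
  rw [coe_powerset_omega]
  have := mk_range_eq_of_injective (setCode_injective.{u})
  rw [mk_set, mk_nat] at this
  simpa using this

theorem natCode_mem_H (hχ : χ.IsRegular) (n : ℕ) : natCode n ∈ H χ :=
  toZFSet_mem_H hχ (by simpa using (natCast_lt_aleph0 (n := n)).trans_le hχ.1)

theorem mk_omega_lt (h : ℵ₀ < χ) :
    #(ZFSet.omega.{u} : Set ZFSet.{u}) < lift.{u + 1} χ := by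
  have h1 : (ZFSet.omega.{u} : Set ZFSet.{u}) = Set.range natCode := by
    ext z; exact mem_omega_iff
  rw [h1]
  exact (mk_le_aleph0_iff.2 (countable_range _).to_subtype).trans_lt (by simpa using lift_lt.{u, u + 1}.2 h)

theorem omega_mem_H (hχ : χ.IsRegular) (h : ℵ₀ < χ) : ZFSet.omega ∈ H χ := by
  refine mem_H_of_forall hχ (fun z hz => ?_) (mk_omega_lt h)
  obtain ⟨n, rfl⟩ := mem_omega_iff.1 hz
  exact natCode_mem_H hχ n

theorem setCode_mem_H (hχ : χ.IsRegular) (h : ℵ₀ < χ) (s : Set ℕ) : setCode s ∈ H χ :=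
  mem_H_of_subset (setCode_subset_omega s) (omega_mem_H hχ h)

theorem powerset_omega_mem_H (hχ : χ.IsRegular) (h : 2 ^ (ℵ₀ : Cardinal.{u}) < χ) :
    ZFSet.omega.powerset ∈ H χ := by
  refine mem_H_of_forall hχ (fun z hz => ?_) ?_
  · obtain ⟨s, rfl⟩ := mem_powerset_omega_iff.1 hz
    exact setCode_mem_H hχ ((cantor _).trans h) s
  · rw [mk_powerset_omega]
    simpa using lift_lt.{u, u + 1}.2 h

theorem inclusionRel_mem_H (hχ : χ.IsRegular) {P : ZFSet.{u}} (hP : P ∈ H χ) :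
    inclusionRel P ∈ H χ := by
  have hreg : (lift.{u + 1} χ).IsRegular := hχ.lift
  refine mem_H_of_forall hχ (fun z hz => ?_) ?_
  · obtain ⟨a, ha, b, hb, rfl, -⟩ := ZFSet.mem_pairSep.1 hz
    exact pair_mem_H hχ (mem_H_of_mem ha hP) (mem_H_of_mem hb hP)
  · have h1 : (inclusionRel P : Set ZFSet.{u}) ⊆
        (fun q : ZFSet.{u} × ZFSet.{u} => ZFSet.pair q.1 q.2) '' ((P : Set ZFSet.{u}) ×ˢ (P : Set ZFSet.{u})) := by
      intro z hz
      obtain ⟨a, ha, b, hb, rfl, -⟩ := ZFSet.mem_pairSep.1 hz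
      exact ⟨(a, b), ⟨ha, hb⟩, rfl⟩
    refine ((mk_le_mk_of_subset h1).trans mk_image_le).trans_lt ?_
    rw [mk_setProd]
    simpa using mul_lt_of_lt hreg.1 (mk_lt_of_mem_H hP) (mk_lt_of_mem_H hP)

theorem pair_mem_inclusionRel {P : ZFSet.{u}} (hx : x ∈ P) (hy : y ∈ P) :
    ZFSet.pair x y ∈ inclusionRel P ↔ x ⊆ y := by
  rw [inclusionRel, ZFSet.mem_pairSep]
  constructor
  · rintro ⟨a, -, b, -, hab, h⟩
    obtain ⟨rfl, rfl⟩ := ZFSet.pair_inj.1 hab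
    exact h
  · exact fun h => ⟨x, hx, y, hy, rfl, h⟩

end SepIDP

namespace SepIDP

/-! ### Ordinals below `ω₁` and `ω₂` -/

/-- Regularity of `κ`. A set of ordinals lives one universe up, so it is shrunk before its supremum
is taken and its size is compared with the lift of `κ`. -/
theorem exists_lt_of_mk_lt {κ : Cardinal.{u}} (hκ : κ.IsRegular) {X : Set Ordinal.{u}}
    (hX : X ⊆ Iio κ.ord) (hc : #X < lift.{u + 1} κ) : ∃ b < κ.ord, ∀ x ∈ X, x < b := by
  have : Small.{u} X := small_of_mk_le hc.le
  have h1 : #(Shrink.{u} X) < κ := by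
    rw [← Cardinal.lift_lt.{u, u + 1}, lift_mk_shrink'']
    exact hc
  have hlim : Order.IsSuccLimit κ.ord := isSuccLimit_ord hκ.1
  refine ⟨Order.succ (⨆ i : Shrink.{u} X, ((equivShrink X).symm i).1), hlim.succ_lt ?_, ?_⟩
  · exact Ordinal.iSup_lt_of_lt_cof (by rwa [hκ.cof_ord]) fun i => hX ((equivShrink X).symm i).2
  · intro x hx
    refine Order.lt_succ_of_le ?_
    have := Ordinal.le_iSup (fun i : Shrink.{u} X => ((equivShrink X).symm i).1)
      (equivShrink X ⟨x, hx⟩)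
    simpa using this

theorem isRegular_aleph_two : (ℵ_ 2 : Cardinal.{u}).IsRegular := by
  have := isRegular_aleph_add_one.{u} 1
  rwa [one_add_one_eq_two] at this

theorem lift_aleph_one' : lift.{u + 1} (ℵ_ 1 : Cardinal.{u}) = ℵ_ 1 := by simp

theorem lift_aleph_two : lift.{u + 1} (ℵ_ 2 : Cardinal.{u}) = ℵ_ 2 := by
  rw [lift_aleph]; congr 1; exact_mod_cast Ordinal.lift_ofNat 2

theorem lt_aleph_two_iff {c : Cardinal.{u}} : c < ℵ_ 2 ↔ c ≤ ℵ_ 1 := by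
  have h : (ℵ_ 2 : Cardinal.{u}) = Order.succ (ℵ_ 1) := by
    rw [succ_aleph, one_add_one_eq_two]
  rw [h, Order.lt_succ_iff]

theorem lt_aleph_one_iff_countable {c : Cardinal.{u}} : c < ℵ_ 1 ↔ c ≤ ℵ₀ := by
  have h : (ℵ_ 1 : Cardinal.{u}) = Order.succ ℵ₀ := by
    rw [← succ_aleph0]
  rw [h, Order.lt_succ_iff]

theorem exists_lt_omega_two {X : Set Ordinal.{u}}
    (hX : X ⊆ Iio (ω_ 2)) (hc : #X ≤ ℵ_ 1) : ∃ b < ω_ 2, ∀ x ∈ X, x < b := by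
  rw [← ord_aleph] at hX ⊢
  refine exists_lt_of_mk_lt isRegular_aleph_two hX ?_
  rw [lift_aleph_two]
  exact lt_aleph_two_iff.2 hc

theorem mk_Iio_le_aleph_one {a : Ordinal.{u}} (ha : a < ω_ 2) : #(Iio a) ≤ ℵ_ 1 := by
  rw [Cardinal.mk_Iio_ordinal, ← lt_aleph_two_iff, ← lift_aleph_two, Cardinal.lift_lt, ← lt_ord, ord_aleph]
  exact ha

theorem mk_Iio_omega_one : #(Iio (ω_ 1 : Ordinal.{u})) = ℵ_ 1 := by simp

theorem mk_Iio_omega_two : #(Iio (ω_ 2 : Ordinal.{u})) = ℵ_ 2 := by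
  rw [Cardinal.mk_Iio_ordinal, card_omega, lift_aleph_two]

theorem countable_Iio_of_lt_omega_one {a : Ordinal.{u}} (ha : a < ω_ 1) : (Iio a).Countable := by
  rw [← le_aleph0_iff_set_countable, Cardinal.mk_Iio_ordinal, ← lt_aleph_one_iff_countable,
    ← lift_aleph_one', Cardinal.lift_lt, ← lt_ord, ord_aleph]
  exact ha

/-! ### First-order notions -/

variable {χ : Cardinal.{u}} {M : Set ZFSet.{u}}

/-- `z` is covered by the image of `y` under the functional relation `f`. -/
def Cover (f z y : ZFSet.{u}) : Prop :=
  (∀ a b c, ZFSet.pair a b ∈ f → ZFSet.pair a c ∈ f → b = c) ∧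
    ∀ q ∈ z, ∃ a ∈ y, ZFSet.pair a q ∈ f

theorem mem_H_of_pair_mem {a b f : ZFSet.{u}} (hf : f ∈ H χ) (h : ZFSet.pair a b ∈ f) :
    a ∈ H χ ∧ b ∈ H χ := by
  have h1 := mem_H_of_mem h hf
  have h2 : ({a, b} : ZFSet.{u}) ∈ H χ := mem_H_of_mem (by simp [ZFSet.pair]) h1
  exact ⟨mem_H_of_mem (by simp) h2, mem_H_of_mem (by simp) h2⟩

namespace Fml

/-- `p` is the ordered pair of `x` and `y`. -/
def isPair (p x y : ℕ) : Fml :=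
  all 10 (iff (mem 10 p) (or (all 11 (iff (mem 11 10) (eq 11 x)))
    (all 11 (iff (mem 11 10) (or (eq 11 x) (eq 11 y))))))

/-- Variables 10 and 11 are bound inside `isPair`; the bounds on the indices prevent capture. In the
same way `pairIn` reserves 9 and `cover` reserves 6, 7, 8. Quantifiers over `H χ` have their true
meaning because `H χ` is transitive and closed under pairs. -/
theorem sat_isPair (hχ : χ.IsRegular) {p x y : ℕ} (hp : p < 10) (hx : x < 10) (hy : y < 10)
    (v : ℕ → H χ) : (isPair p x y).Sat v ↔ (v p : ZFSet.{u}) = ZFSet.pair (v x) (v y) := by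
  have h1 : p ≠ 10 := hp.ne
  have h2 : x ≠ 10 := hx.ne
  have h3 : y ≠ 10 := hy.ne
  have h4 : x ≠ 11 := by omega
  have h5 : y ≠ 11 := by omega
  simp only [isPair, sat_all, sat_iff, sat_or, sat_mem, sat_eq, Function.update_self,
    Function.update_of_ne, h1, h2, h3, h4, h5, ne_eq, not_false_eq_true,
    show (10 : ℕ) ≠ 11 by norm_num]
  have e1 : ∀ a : H χ, (∀ w : H χ, w.1 ∈ a.1 ↔ w = v x) ↔ a.1 = {(v x).1} := by
    intro a
    constructor
    · intro h
      ext w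
      rw [ZFSet.mem_singleton]
      constructor
      · exact fun hw => congrArg Subtype.val ((h ⟨w, mem_H_of_mem hw a.2⟩).1 hw)
      · rintro rfl
        exact (h _).2 rfl
    · intro h w
      rw [h, ZFSet.mem_singleton, Subtype.ext_iff]
  have e2 : ∀ a : H χ, (∀ w : H χ, w.1 ∈ a.1 ↔ (w = v x ∨ w = v y)) ↔
      a.1 = {(v x).1, (v y).1} := by
    intro a
    constructor
    · intro h
      ext w
      rw [ZFSet.mem_pair]
      constructor
      · intro hw
        have := (h ⟨w, mem_H_of_mem hw a.2⟩).1 hw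
        simpa [Subtype.ext_iff] using this
      · rintro (rfl | rfl)
        · exact (h _).2 (Or.inl rfl)
        · exact (h _).2 (Or.inr rfl)
    · intro h w
      rw [h, ZFSet.mem_pair, Subtype.ext_iff, Subtype.ext_iff]
  simp only [e1, e2]
  constructor
  · intro h
    ext w
    rw [ZFSet.pair, ZFSet.mem_pair]
    constructor
    · intro hw
      exact (h ⟨w, mem_H_of_mem hw (v p).2⟩).1 hw
    · rintro (rfl | rfl)
      · exact (h ⟨_, singleton_mem_H hχ (v x).2⟩).2 (Or.inl rfl)
      · exact (h ⟨_, pair_elem_H hχ (v x).2 (v y).2⟩).2 (Or.inr rfl)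
  · intro h w
    rw [h, ZFSet.pair, ZFSet.mem_pair]

/-- The pair of `i` and `j` belongs to `f`. -/
def pairIn (i j f : ℕ) : Fml := ex 9 (and (isPair 9 i j) (mem 9 f))

theorem sat_pairIn (hχ : χ.IsRegular) {i j f : ℕ} (hi : i < 9) (hj : j < 9) (hf : f < 9)
    (v : ℕ → H χ) :
    (pairIn i j f).Sat v ↔ ZFSet.pair (v i) (v j) ∈ (v f : ZFSet.{u}) := by
  simp only [pairIn, sat_ex, sat_and, sat_mem,
    sat_isPair hχ (show 9 < 10 by norm_num) (show i < 10 by omega) (show j < 10 by omega),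
    Function.update_self, Function.update_of_ne hi.ne, Function.update_of_ne hj.ne,
    Function.update_of_ne hf.ne]
  constructor
  · rintro ⟨p, hp, h⟩
    rwa [← hp]
  · exact fun h => ⟨⟨_, pair_mem_H hχ (v i).2 (v j).2⟩, rfl, h⟩

/-- `z` is covered by the image of `y` under the functional relation `f`. -/
def cover (f z y : ℕ) : Fml :=
  and (all 6 (all 7 (all 8 (imp (pairIn 6 7 f) (imp (pairIn 6 8 f) (eq 7 8))))))
    (all 7 (imp (mem 7 z) (ex 6 (and (mem 6 y) (pairIn 6 7 f)))))

theorem sat_cover (hχ : χ.IsRegular) {f z y : ℕ} (hf : f < 6) (hz : z < 6) (hy : y < 6)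
    (v : ℕ → H χ) : (cover f z y).Sat v ↔ Cover (v f : ZFSet.{u}) (v z) (v y) := by
  have a1 : f ≠ 6 := by omega
  have a2 : f ≠ 7 := by omega
  have a3 : f ≠ 8 := by omega
  have b2 : z ≠ 7 := by omega
  have c1 : y ≠ 6 := by omega
  have c2 : y ≠ 7 := by omega
  simp only [cover, sat_and, sat_all, sat_imp, sat_ex, sat_mem, sat_eq,
    sat_pairIn hχ (show 6 < 9 by norm_num) (show 7 < 9 by norm_num) (show f < 9 by omega),
    sat_pairIn hχ (show 6 < 9 by norm_num) (show 8 < 9 by norm_num) (show f < 9 by omega),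
    Function.update_self, Function.update_of_ne, ne_eq, not_false_eq_true, a1, a2, a3, b2, c1,
    c2, show (6 : ℕ) ≠ 7 by norm_num, show (6 : ℕ) ≠ 8 by norm_num,
    show (7 : ℕ) ≠ 8 by norm_num, show (7 : ℕ) ≠ 6 by norm_num]
  constructor
  · rintro ⟨h1, h2⟩
    refine ⟨fun a b c hab hac => ?_, fun q hq => ?_⟩
    · have := mem_H_of_pair_mem (v f).2 hab
      exact congrArg Subtype.val (h1 ⟨a, this.1⟩ ⟨b, this.2⟩
        ⟨c, (mem_H_of_pair_mem (v f).2 hac).2⟩ hab hac)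
    · obtain ⟨a, ha, haf⟩ := h2 ⟨q, mem_H_of_mem hq (v z).2⟩ hq
      exact ⟨a, ha, haf⟩
  · rintro ⟨h1, h2⟩
    refine ⟨fun a b c hab hac => Subtype.ext (h1 _ _ _ hab hac), fun q hq => ?_⟩
    obtain ⟨a, ha, haf⟩ := h2 q hq
    exact ⟨⟨a, mem_H_of_mem ha (v y).2⟩, ha, haf⟩

end Fml

/-- A valuation from a list of elements of `H χ`. -/
def valuation (a b c d : H χ) : ℕ → H χ
  | 0 => a
  | 1 => b
  | 2 => c
  | _ => d

theorem valuation_mem {a b c d : H χ} (ha : a.1 ∈ M) (hb : b.1 ∈ M) (hc : c.1 ∈ M) (hd : d.1 ∈ M)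
    (i : ℕ) : (valuation a b c d i : ZFSet.{u}) ∈ M := by
  match i with
  | 0 => exact ha
  | 1 => exact hb
  | 2 => exact hc
  | _ + 3 => exact hd

theorem IsElemSubmodel.exists_pair_mem (hM : IsElemSubmodel χ M) (hχ : χ.IsRegular)
    {f x : ZFSet.{u}} (hf : f ∈ M) (hx : x ∈ M) (h : ∃ y, ZFSet.pair x y ∈ f) :
    ∃ y ∈ M, ZFSet.pair x y ∈ f := by
  obtain ⟨y, hy⟩ := h
  let f' : H χ := ⟨f, hM.subset_H hf⟩
  let x' : H χ := ⟨x, hM.subset_H hx⟩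
  obtain ⟨z, hz, hzf⟩ := hM.exists_mem (Fml.pairIn 0 2 1) 2 (valuation x' f' x' x')
    (valuation_mem hx hf hx hx)
    ⟨⟨y, (mem_H_of_pair_mem f'.2 hy).2⟩, by
      rw [Fml.sat_pairIn hχ (by norm_num) (by norm_num) (by norm_num)]; exact hy⟩
  rw [Fml.sat_pairIn hχ (by norm_num) (by norm_num) (by norm_num)] at hzf
  exact ⟨z, hz, hzf⟩

theorem IsElemSubmodel.fst_mem (hM : IsElemSubmodel χ M) (hχ : χ.IsRegular)
    {x y : ZFSet.{u}} (h : ZFSet.pair x y ∈ M) : x ∈ M := by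
  let p : H χ := ⟨_, hM.subset_H h⟩
  have hs := mem_H_of_pair_mem (χ := χ) (singleton_mem_H hχ p.2) (ZFSet.mem_singleton.2 rfl)
  obtain ⟨z, hz, hzf⟩ := hM.exists_mem (Fml.ex 1 (Fml.isPair 2 0 1)) 0 (valuation p p p p)
    (valuation_mem h h h h)
    ⟨⟨x, hs.1⟩, by
      rw [Fml.sat_ex]
      refine ⟨⟨y, hs.2⟩, ?_⟩
      rw [Fml.sat_isPair hχ (by norm_num) (by norm_num) (by norm_num)]; rfl⟩
  rw [Fml.sat_ex] at hzf
  obtain ⟨w, hw⟩ := hzf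
  rw [Fml.sat_isPair hχ (by norm_num) (by norm_num) (by norm_num)] at hw
  have : x = z.1 := (ZFSet.pair_inj.1 hw).1
  rwa [this]

/-- A covering map can be found in `M` by elementarity, and its values at arguments from `y ⊆ M` are
in `M`; these values exhaust `z`. -/
theorem IsElemSubmodel.subset_of_cover (hM : IsElemSubmodel χ M) (hχ : χ.IsRegular)
    {f z y : ZFSet.{u}} (hz : z ∈ M) (hy : y ∈ M) (hyM : (y : Set ZFSet.{u}) ⊆ M) (hf : f ∈ H χ)
    (h : Cover f z y) : (z : Set ZFSet.{u}) ⊆ M := by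
  obtain ⟨g, hg, hgc⟩ := hM.exists_mem (Fml.cover 2 0 1) 2
    (valuation ⟨z, hM.subset_H hz⟩ ⟨y, hM.subset_H hy⟩ ⟨z, hM.subset_H hz⟩ ⟨z, hM.subset_H hz⟩)
    (valuation_mem hz hy hz hz)
    ⟨⟨f, hf⟩, by
      rw [Fml.sat_cover hχ (by norm_num) (by norm_num) (by norm_num)]; exact h⟩
  rw [Fml.sat_cover hχ (by norm_num) (by norm_num) (by norm_num)] at hgc
  intro q hq
  obtain ⟨a, ha, hag⟩ := hgc.2 q hq
  obtain ⟨q', hq', hq'g⟩ := hM.exists_pair_mem hχ hg (hyM ha) ⟨q, hag⟩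
  rwa [hgc.1 _ _ _ hag hq'g]

theorem exists_cover (hχ : χ.IsRegular) {z y : ZFSet.{u}} (hz : z ∈ H χ) (hy : y ∈ H χ)
    (h : #(z : Set ZFSet.{u}) ≤ #(y : Set ZFSet.{u})) : ∃ f ∈ H χ, Cover f z y := by
  obtain ⟨g⟩ := h
  have : Small.{u} (z : Set ZFSet.{u}) := inferInstanceAs (Small.{u} z)
  refine ⟨ZFSet.range fun q : (z : Set ZFSet.{u}) => ZFSet.pair (g q) q, ?_, ?_, ?_⟩
  · refine range_mem_H hχ (fun q => pair_mem_H hχ (mem_H_of_mem (g q).2 hy)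
      (mem_H_of_mem q.2 hz)) (mk_range_le.trans_lt (mk_lt_of_mem_H hz))
  · intro a b c hb hc
    obtain ⟨q, hq⟩ := ZFSet.mem_range.1 hb
    obtain ⟨r, hr⟩ := ZFSet.mem_range.1 hc
    obtain ⟨h1, h2⟩ := ZFSet.pair_inj.1 hq
    obtain ⟨h3, h4⟩ := ZFSet.pair_inj.1 hr
    have : q = r := g.injective (Subtype.ext (h1.trans h3.symm))
    rw [← h2, ← h4, this]
  · intro q hq
    exact ⟨g ⟨q, hq⟩, (g ⟨q, hq⟩).2, ZFSet.mem_range.2 ⟨⟨q, hq⟩, rfl⟩⟩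

end SepIDP

namespace SepIDP

/-! ### The `ℵ₂`-ideal property under `2^ℵ₀ = ℵ₂` -/

variable {χ : Cardinal.{u}} {M : Set ZFSet.{u}}

/-- `R` is a strict linear order of `Q` in which the images of `y` are strictly bounded and each
initial segment is covered by an image of `y`. -/
structure IsTall (χ : Cardinal.{u}) (Q y R : ZFSet.{u}) : Prop where
  irrefl : ∀ q ∈ Q, ZFSet.pair q q ∉ R
  total : ∀ q ∈ Q, ∀ r ∈ Q, q = r ∨ ZFSet.pair q r ∈ R ∨ ZFSet.pair r q ∈ R
  bounded : ∀ x ∈ H χ, (∃ f ∈ H χ, Cover f x y) → ∃ q ∈ Q, ∀ r ∈ Q, r ∈ x → ZFSet.pair r q ∈ R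
  small : ∀ q ∈ Q, ∃ z ∈ H χ, (∃ f ∈ H χ, Cover f z y) ∧ ∀ r, ZFSet.pair r q ∈ R → r ∈ z

namespace Fml

/-- The set `4` is an image of `1` and contains the `2`-predecessors of `3`. -/
def coversBelow : Fml := and (ex 5 (cover 5 4 1)) (all 5 (imp (pairIn 5 3 2) (mem 5 4)))

theorem sat_coversBelow (hχ : χ.IsRegular) (v : ℕ → H χ) :
    coversBelow.Sat v ↔ (∃ f ∈ H χ, Cover f (v 4 : ZFSet.{u}) (v 1)) ∧
      ∀ r, ZFSet.pair r (v 3 : ZFSet.{u}) ∈ (v 2 : ZFSet.{u}) → r ∈ (v 4 : ZFSet.{u}) := by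
  simp only [coversBelow, sat_and, sat_ex, sat_all, sat_imp, sat_mem,
    sat_cover hχ (show 5 < 6 by norm_num) (show 4 < 6 by norm_num) (show 1 < 6 by norm_num),
    sat_pairIn hχ (show 5 < 9 by norm_num) (show 3 < 9 by norm_num) (show 2 < 9 by norm_num),
    Function.update_self, Function.update_of_ne, ne_eq, not_false_eq_true,
    show (4 : ℕ) ≠ 5 by norm_num, show (1 : ℕ) ≠ 5 by norm_num, show (3 : ℕ) ≠ 5 by norm_num,
    show (2 : ℕ) ≠ 5 by norm_num]
  refine and_congr ?_ ?_
  · simp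
  · exact ⟨fun h r hr => h ⟨r, (mem_H_of_pair_mem (v 2).2 hr).1⟩ hr, fun h r hr => h _ hr⟩

/-- `2` is tall for `0` and `1`. -/
def tall : Fml :=
  and (and (all 3 (imp (mem 3 0) (neg (pairIn 3 3 2))))
    (all 3 (all 4 (imp (mem 3 0) (imp (mem 4 0) (or (eq 3 4) (or (pairIn 3 4 2) (pairIn 4 3 2))))))))
  (and (all 3 (imp (ex 4 (cover 4 3 1))
      (ex 4 (and (mem 4 0) (all 5 (imp (mem 5 0) (imp (mem 5 3) (pairIn 5 4 2))))))))
    (all 3 (imp (mem 3 0) (ex 4 coversBelow))))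

theorem sat_tall (hχ : χ.IsRegular) (v : ℕ → H χ) :
    tall.Sat v ↔ IsTall χ (v 0 : ZFSet.{u}) (v 1) (v 2) := by
  simp only [tall, sat_and, sat_ex, sat_all, sat_imp, sat_mem, sat_neg, sat_or, sat_eq,
    sat_coversBelow hχ,
    sat_cover hχ (show 4 < 6 by norm_num) (show 3 < 6 by norm_num) (show 1 < 6 by norm_num),
    sat_pairIn hχ (show 3 < 9 by norm_num) (show 3 < 9 by norm_num) (show 2 < 9 by norm_num),
    sat_pairIn hχ (show 3 < 9 by norm_num) (show 4 < 9 by norm_num) (show 2 < 9 by norm_num),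
    sat_pairIn hχ (show 4 < 9 by norm_num) (show 3 < 9 by norm_num) (show 2 < 9 by norm_num),
    sat_pairIn hχ (show 5 < 9 by norm_num) (show 4 < 9 by norm_num) (show 2 < 9 by norm_num),
    Function.update_self, Function.update_of_ne, ne_eq, not_false_eq_true,
    show (0 : ℕ) ≠ 3 by norm_num, show (0 : ℕ) ≠ 4 by norm_num, show (0 : ℕ) ≠ 5 by norm_num,
    show (1 : ℕ) ≠ 3 by norm_num, show (1 : ℕ) ≠ 4 by norm_num,
    show (2 : ℕ) ≠ 3 by norm_num, show (2 : ℕ) ≠ 4 by norm_num, show (2 : ℕ) ≠ 5 by norm_num,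
    show (3 : ℕ) ≠ 4 by norm_num, show (3 : ℕ) ≠ 5 by norm_num, show (4 : ℕ) ≠ 5 by norm_num]
  have hmem : ∀ {q : ZFSet.{u}}, q ∈ (v 0 : ZFSet.{u}) → q ∈ H χ := fun h =>
    mem_H_of_mem h (v 0).2
  constructor
  · rintro ⟨⟨h1, h2⟩, h3, h4⟩
    refine ⟨fun q hq => h1 ⟨q, hmem hq⟩ hq, fun q hq r hr => ?_, fun x hx hf => ?_,
      fun q hq => ?_⟩
    · have := h2 ⟨q, hmem hq⟩ ⟨r, hmem hr⟩ hq hr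
      rwa [Subtype.mk.injEq] at this
    · obtain ⟨f, hf, hc⟩ := hf
      obtain ⟨q, hq, h⟩ := h3 ⟨x, hx⟩ ⟨⟨f, hf⟩, hc⟩
      exact ⟨q, hq, fun r hr => h ⟨r, hmem hr⟩ hr⟩
    · obtain ⟨z, hz⟩ := h4 ⟨q, hmem hq⟩ hq
      exact ⟨z, z.2, hz⟩
  · rintro ⟨h1, h2, h3, h4⟩
    refine ⟨⟨fun q hq => h1 _ hq, fun q r hq hr => ?_⟩, fun x hx => ?_, fun q hq => ?_⟩
    · rw [Subtype.ext_iff]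
      exact h2 _ hq _ hr
    · obtain ⟨f, hf⟩ := hx
      obtain ⟨q, hq, h⟩ := h3 x x.2 ⟨f, f.2, hf⟩
      exact ⟨⟨q, hmem hq⟩, hq, fun r hr => h r hr⟩
    · obtain ⟨z, hz, h⟩ := h4 q hq
      exact ⟨⟨z, hz⟩, h⟩

end Fml

/-- The order of `ω₂` is transported to `Q` by a bijection. Images of `y` have size at most `ℵ₁`,
hence are bounded in `ω₂`, and proper initial segments of `ω₂` have size at most `ℵ₁`. `IsTall`
records these two facts in a form that elementarity can carry into `M`. -/
theorem exists_isTall (hχ : χ.IsRegular) {Q y : ZFSet.{u}} (hQ : Q ∈ H χ) (hy : y ∈ H χ)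
    (hQc : #(Q : Set ZFSet.{u}) = ℵ_ 2) (hyc : #(y : Set ZFSet.{u}) = ℵ_ 1) :
    ∃ R ∈ H χ, IsTall χ Q y R := by
  have hreg : (lift.{u + 1} χ).IsRegular := hχ.lift
  obtain ⟨e⟩ := Cardinal.eq.1 (hQc.trans mk_Iio_omega_two.symm)
  let S : Set ZFSet.{u} := {p | ∃ a b : (Q : Set ZFSet.{u}), e a < e b ∧ p = ZFSet.pair a b}
  have hSH : S ⊆ H χ := by
    rintro _ ⟨a, b, -, rfl⟩
    exact pair_mem_H hχ (mem_H_of_mem a.2 hQ) (mem_H_of_mem b.2 hQ)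
  have hSc : #S < lift.{u + 1} χ := by
    have h1 : S ⊆ (fun q : ZFSet.{u} × ZFSet.{u} => ZFSet.pair q.1 q.2) ''
        ((Q : Set ZFSet.{u}) ×ˢ (Q : Set ZFSet.{u})) := by
      rintro _ ⟨a, b, -, rfl⟩
      exact ⟨(a, b), ⟨a.2, b.2⟩, rfl⟩
    refine ((mk_le_mk_of_subset h1).trans mk_image_le).trans_lt ?_
    rw [mk_setProd]
    simpa using mul_lt_of_lt hreg.1 (mk_lt_of_mem_H hQ) (mk_lt_of_mem_H hQ)
  have key : ∀ a b : (Q : Set ZFSet.{u}), ZFSet.pair a.1 b.1 ∈ toZF S ↔ e a < e b := by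
    intro a b
    rw [mem_toZF hSc.le]
    constructor
    · rintro ⟨c, d, h, hcd⟩
      obtain ⟨h1, h2⟩ := ZFSet.pair_inj.1 hcd
      rwa [Subtype.ext h1, Subtype.ext h2]
    · exact fun h => ⟨a, b, h, rfl⟩
  refine ⟨toZF S, toZF_mem_H hχ hSH hSc, ?_, ?_, ?_, ?_⟩
  · intro q hq
    rw [key ⟨q, hq⟩ ⟨q, hq⟩]
    exact lt_irrefl _
  · intro q hq r hr
    rw [key ⟨q, hq⟩ ⟨r, hr⟩, key ⟨r, hr⟩ ⟨q, hq⟩]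
    rcases lt_trichotomy (e ⟨q, hq⟩) (e ⟨r, hr⟩) with h | h | h
    · exact Or.inr (Or.inl h)
    · exact Or.inl (congrArg Subtype.val (e.injective h))
    · exact Or.inr (Or.inr h)
  · rintro x - ⟨f, -, hf⟩
    have hxc : #(x : Set ZFSet.{u}) ≤ ℵ_ 1 := by
      rw [← hyc]
      choose g hg hgf using hf.2
      refine mk_le_of_injective (f := fun q : (x : Set ZFSet.{u}) =>
        (⟨g q q.2, hg q q.2⟩ : (y : Set ZFSet.{u}))) fun q r h => ?_
      have h' : g q q.2 = g r r.2 := congrArg Subtype.val h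
      have h1 := hgf q q.2
      rw [h'] at h1
      exact Subtype.ext (hf.1 _ _ _ h1 (hgf r r.2))
    let X : Set Ordinal.{u} := (fun a => (e a).1) '' {a : (Q : Set ZFSet.{u}) | a.1 ∈ x}
    obtain ⟨b, hb, hbX⟩ := exists_lt_omega_two (X := X) (by rintro _ ⟨a, -, rfl⟩; exact (e a).2)
      (by
        refine mk_image_le.trans (le_trans ?_ hxc)
        exact mk_le_of_injective (f := fun a : {a : (Q : Set ZFSet.{u}) | a.1 ∈ x} =>
          (⟨a.1.1, a.2⟩ : (x : Set ZFSet.{u}))) fun a b h =>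
            Subtype.ext (Subtype.ext (Subtype.mk.inj h)))
    refine ⟨e.symm ⟨b, hb⟩, (e.symm ⟨b, hb⟩).2, fun r hr hrx => ?_⟩
    rw [key ⟨r, hr⟩, Equiv.apply_symm_apply]
    exact hbX _ ⟨⟨r, hr⟩, hrx, rfl⟩
  · intro q hq
    let Z : Set ZFSet.{u} := {r | ∃ a : (Q : Set ZFSet.{u}), e a < e ⟨q, hq⟩ ∧ r = a}
    have hZc : #Z ≤ ℵ_ 1 := by
      refine le_trans ?_ (mk_Iio_le_aleph_one (e ⟨q, hq⟩).2)
      have h1 : Z ⊆ (fun i : Iio (e ⟨q, hq⟩).1 =>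
          (e.symm ⟨i.1, mem_Iio.2 (lt_trans (mem_Iio.1 i.2) (mem_Iio.1 (e ⟨q, hq⟩).2))⟩ : ZFSet.{u})) '' univ := by
        rintro _ ⟨a, ha, rfl⟩
        exact ⟨⟨(e a).1, ha⟩, trivial, by simp⟩
      exact ((mk_le_mk_of_subset h1).trans mk_image_le).trans (mk_set_le _)
    have hZc' : #Z < lift.{u + 1} χ := by
      refine hZc.trans_lt ?_
      rw [← hyc]
      exact mk_lt_of_mem_H hy
    have hZH : toZF Z ∈ H χ := by
      refine toZF_mem_H hχ ?_ hZc'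
      rintro _ ⟨a, -, rfl⟩
      exact mem_H_of_mem a.2 hQ
    refine ⟨toZF Z, hZH, exists_cover hχ hZH hy ?_, ?_⟩
    · rw [coe_toZF hZc'.le, hyc]
      exact hZc
    · intro r hr
      rw [mem_toZF hZc'.le]
      obtain ⟨c, d, h, hcd⟩ := (mem_toZF hSc.le).1 hr
      obtain ⟨rfl, rfl⟩ := ZFSet.pair_inj.1 hcd
      exact ⟨c, h, rfl⟩

theorem exists_subset_mk_eq_aleph_one (hMc : #M = ℵ_ 2) {X : Set ZFSet.{u}} (hX : X ⊆ M)
    (hXc : #X ≤ ℵ_ 1) : ∃ Y : Set ZFSet.{u}, X ⊆ Y ∧ Y ⊆ M ∧ #Y = ℵ_ 1 := by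
  have h1 : (ℵ_ 1 : Cardinal.{u + 1}) ≤ #M := by
    rw [hMc]; exact (lt_aleph_two_iff.2 le_rfl).le
  obtain ⟨Z, hZM, hZ⟩ := le_mk_iff_exists_subset.1 h1
  refine ⟨X ∪ Z, subset_union_left, union_subset hX hZM, le_antisymm ?_ ?_⟩
  · refine (mk_union_le _ _).trans ?_
    rw [hZ]
    exact (add_le_add_left hXc _).trans (add_eq_self (aleph0_le_aleph 1)).le
  · rw [← hZ]
    exact mk_le_mk_of_subset subset_union_right

theorem IsElemSubmodel.subset_of_mk_eq_aleph_two (hM : IsElemSubmodel χ M) (hχ : χ.IsRegular)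
    (hMc : #M = ℵ_ 2) (hcof : InternallyCofinal (ℵ_ 1) M) {Q : ZFSet.{u}} (hQ : Q ∈ M)
    (hQc : #(Q : Set ZFSet.{u}) = ℵ_ 2) : (Q : Set ZFSet.{u}) ⊆ M := by
  obtain ⟨Y, -, hYM, hYc⟩ := exists_subset_mk_eq_aleph_one hMc (empty_subset M) (by simp)
  obtain ⟨y, hyM, hy, hyc, -⟩ := hcof Y hYM hYc
  have hQH := hM.subset_H hQ
  have hyH := hM.subset_H hyM
  obtain ⟨R₀, hR₀, hR₀t⟩ := exists_isTall hχ hQH hyH hQc hyc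
  obtain ⟨R, hR, hRt⟩ := hM.exists_mem Fml.tall 2
    (valuation ⟨Q, hQH⟩ ⟨y, hyH⟩ ⟨y, hyH⟩ ⟨y, hyH⟩) (valuation_mem hQ hyM hyM hyM)
    ⟨⟨R₀, hR₀⟩, by rw [Fml.sat_tall hχ]; exact hR₀t⟩
  rw [Fml.sat_tall hχ] at hRt
  replace hRt : IsTall χ Q y R := hRt
  -- `Q ∩ M` is an initial segment: the predecessors of `r ∈ M` lie in some `z' ∈ M` that is an
  -- image of `y ⊆ M`, so `z' ⊆ M`.
  have hdown : ∀ q ∈ Q, ∀ r ∈ Q, r ∈ M → ZFSet.pair q r ∈ R.1 → q ∈ M := by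
    intro q _ r hr hrM hqr
    obtain ⟨z, hz, h⟩ := hRt.small r hr
    have h0 := valuation_mem hrM hyM hR hrM (a := ⟨r, hM.subset_H hrM⟩) (b := ⟨y, hyH⟩) (c := R)
      (d := ⟨r, hM.subset_H hrM⟩)
    obtain ⟨z', hz', hzt⟩ := hM.exists_mem Fml.coversBelow 4 _ h0
      ⟨⟨z, hz⟩, by rw [Fml.sat_coversBelow hχ]; exact h⟩
    rw [Fml.sat_coversBelow hχ] at hzt
    obtain ⟨⟨f, hf, hfc⟩, hzt⟩ := hzt
    exact hM.subset_of_cover hχ hz' hyM hy hf hfc (hzt q hqr)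
  intro q hq
  by_contra hqM
  have hbelow : ∀ r ∈ Q, r ∈ M → ZFSet.pair r q ∈ R.1 := by
    intro r hr hrM
    rcases hRt.total q hq r hr with rfl | h | h
    · exact absurd hrM hqM
    · exact absurd (hdown q hq r hr hrM h) hqM
    · exact h
  obtain ⟨z, hz, ⟨f, hf, hfc⟩, hzb⟩ := hRt.small q hq
  -- A missing `q` lies above the whole trace, so the trace is contained in an image of `y`.
  have hXc : #((Q : Set ZFSet.{u}) ∩ M : Set ZFSet.{u}) ≤ ℵ_ 1 := by
    have h1 : (Q : Set ZFSet.{u}) ∩ M ⊆ (z : Set ZFSet.{u}) := fun r hr => hzb r (hbelow r hr.1 hr.2)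
    refine (mk_le_mk_of_subset h1).trans ?_
    rw [← hyc]
    choose g hg hgf using hfc.2
    refine mk_le_of_injective (f := fun q : (z : Set ZFSet.{u}) =>
      (⟨g q q.2, hg q q.2⟩ : (y : Set ZFSet.{u}))) fun q r h => ?_
    have h' : g q q.2 = g r r.2 := congrArg Subtype.val h
    have h1 := hgf q q.2
    rw [h'] at h1
    exact Subtype.ext (hfc.1 _ _ _ h1 (hgf r r.2))
  obtain ⟨Y', hXY, hY'M, hY'c⟩ := exists_subset_mk_eq_aleph_one hMc inter_subset_right hXc
  obtain ⟨y', hy'M, -, hy'c, hy'⟩ := hcof Y' hY'M hY'c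
  obtain ⟨b₀, hb₀, hb₀y⟩ := hRt.bounded y' (hM.subset_H hy'M)
    (exists_cover hχ (hM.subset_H hy'M) hyH (hy'c.trans hyc.symm).le)
  let φ : Fml := Fml.and (Fml.mem 4 0) (Fml.all 5 (Fml.imp (Fml.mem 5 0)
    (Fml.imp (Fml.mem 5 1) (Fml.pairIn 5 4 2))))
  have hφ : ∀ v : ℕ → H χ, φ.Sat v ↔ ((v 4 : ZFSet.{u}) ∈ (v 0 : ZFSet.{u}) ∧
      ∀ r : H χ, r.1 ∈ (v 0 : ZFSet.{u}) → r.1 ∈ (v 1 : ZFSet.{u}) →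
        ZFSet.pair r.1 (v 4) ∈ (v 2 : ZFSet.{u})) := by
    intro v
    simp only [φ, Fml.sat_and, Fml.sat_all, Fml.sat_imp, Fml.sat_mem, Fml.sat_pairIn hχ
      (show 5 < 9 by norm_num) (show 4 < 9 by norm_num) (show 2 < 9 by norm_num),
      Function.update_self, Function.update_of_ne, ne_eq, not_false_eq_true,
      show (0 : ℕ) ≠ 5 by norm_num, show (1 : ℕ) ≠ 5 by norm_num, show (2 : ℕ) ≠ 5 by norm_num,
      show (4 : ℕ) ≠ 5 by norm_num]
  obtain ⟨b, hbM, hb⟩ := hM.exists_mem φ 4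
    (valuation ⟨Q, hQH⟩ ⟨y', hM.subset_H hy'M⟩ R R) (valuation_mem hQ hy'M hR hR)
    ⟨⟨b₀, mem_H_of_mem hb₀ hQH⟩, by
      rw [hφ]
      exact ⟨hb₀, fun r hr hry => hb₀y r hr hry⟩⟩
  rw [hφ] at hb
  -- The strict bound `b` of `y' ∩ Q` was found in `M`, hence belongs to the trace covered by `y'`
  -- and lies below itself.
  exact hRt.irrefl b hb.1 (hb.2 b hb.1 (hy' (hXY ⟨hb.1, hbM⟩)))

theorem alephTwoIDP_of_continuum_eq (h : (2 : Cardinal.{u}) ^ (ℵ₀ : Cardinal.{u}) = ℵ_ 2) :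
    AlephTwoIDP (ZFSet.omega.{u}.powerset) (inclusionRel ZFSet.omega.{u}.powerset) := by
  -- The threshold `0` suffices: membership of the pair in `M ⊆ H χ` already makes `χ` large enough.
  refine ⟨0, fun χ _ hχ M hM hMc hP hcof => ⟨inter_subset_left, ?_⟩⟩
  have hPM : (ZFSet.omega.{u}.powerset : Set ZFSet.{u}) ⊆ M := by
    refine hM.subset_of_mk_eq_aleph_two hχ hMc hcof (hM.fst_mem hχ hP) ?_
    rw [mk_powerset_omega, ← lift_aleph_two, ← h]
    simp
  have hlt : (1 : Cardinal.{u + 1}) < ℵ_ 2 :=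
    one_lt_aleph0.trans_le (aleph0_le_aleph 2)
  intro p hp
  have hpp : ZFSet.pair p p ∈ inclusionRel ZFSet.omega.{u}.powerset :=
    (pair_mem_inclusionRel hp hp).2 subset_rfl
  constructor
  · refine ⟨{p}, ?_, by rwa [mk_singleton], fun q _ h => ⟨p, rfl, h⟩⟩
    rintro _ rfl
    exact ⟨⟨hp, hPM hp⟩, hpp⟩
  · refine ⟨{p}, ?_, by rwa [mk_singleton], fun q _ h => ⟨p, rfl, h⟩⟩
    rintro _ rfl
    exact ⟨⟨hp, hPM hp⟩, hpp⟩

end SepIDP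

namespace SepIDP

/-! ### Almost disjoint families -/

/-- A diagonal set: almost disjoint from countably many sets and meeting countably many sets that
are positive with respect to the generated ideal. -/
theorem exists_almostDisjoint_hitting {F S : Set (Set ℕ)} (hF : F.Countable) (hS : S.Countable) :
    ∃ A : Set ℕ, (∀ f ∈ F, (A ∩ f).Finite) ∧
      ∀ s ∈ S, (∀ G ⊆ F, G.Finite → (s \ ⋃₀ G).Infinite) → (A ∩ s).Infinite := by
  let S' : Set (Set ℕ) := {s | s ∈ S ∧ ∀ G ⊆ F, G.Finite → (s \ ⋃₀ G).Infinite}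
  have hS' : S'.Countable := hS.mono fun s hs => hs.1
  rcases S'.eq_empty_or_nonempty with h0 | hne
  · refine ⟨∅, by simp, fun s hs h => ?_⟩
    have : s ∈ S' := ⟨hs, h⟩
    simp [h0] at this
  -- Inserting `∅` allows an enumeration by `ℕ` even when `F` is empty; it is removed again where a
  -- subfamily of `F` is needed.
  obtain ⟨f, hf⟩ := (hF.insert ∅).exists_eq_range (insert_nonempty _ _)
  obtain ⟨g, hg⟩ := hS'.exists_eq_range hne
  -- Unpairing `k` serves each `g j` infinitely often. Avoiding `f i` from stage `i + 1` on gives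
  -- almost disjointness, and `k < p` makes the points chosen for a fixed `g j` unbounded.
  have hp : ∀ k : ℕ, ∃ p, p ∈ g (Nat.unpair k).1 ∧ (∀ i < k, p ∉ f i) ∧ k < p := by
    intro k
    have h1 : g (Nat.unpair k).1 ∈ S' := hg ▸ mem_range_self _
    have h2 := h1.2 ((f '' Iio k) \ {∅}) (by
      rintro _ ⟨⟨i, -, rfl⟩, hi⟩
      have : f i ∈ insert ∅ F := hf ▸ mem_range_self i
      exact this.resolve_left hi) (((finite_Iio k).image f).subset sdiff_subset)
    obtain ⟨p, hp, hkp⟩ := h2.exists_gt k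
    refine ⟨p, hp.1, fun i hi hpi => hp.2 ⟨f i, ⟨⟨i, hi, rfl⟩, ?_⟩, hpi⟩, hkp⟩
    exact fun h => (h ▸ hpi : p ∈ (∅ : Set ℕ))
  choose p hpg hpf hpk using hp
  refine ⟨range p, fun a ha => ?_, fun s hs h => ?_⟩
  · obtain ⟨i, rfl⟩ : a ∈ range f := hf ▸ mem_insert_of_mem _ ha
    refine ((finite_Iic i).image p).subset ?_
    rintro _ ⟨⟨k, rfl⟩, hk⟩
    exact ⟨k, not_lt.1 fun hik => hpf k i hik hk, rfl⟩
  · obtain ⟨j, rfl⟩ : s ∈ range g := hg ▸ ⟨hs, h⟩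
    refine infinite_of_not_bddAbove ?_
    rintro ⟨b, hb⟩
    have h1 := hpg (Nat.pair j b)
    rw [Nat.unpair_pair] at h1
    have h2 := hb ⟨⟨_, rfl⟩, h1⟩
    have h3 := hpk (Nat.pair j b)
    have h4 := Nat.right_le_pair j b
    omega

theorem sdiff_sUnion_infinite {a : Set ℕ} (ha : a.Infinite) {G : Set (Set ℕ)} (hG : G.Finite)
    (h : ∀ g ∈ G, (a ∩ g).Finite) : (a \ ⋃₀ G).Infinite := by
  have h1 : (a ∩ ⋃₀ G).Finite := by
    rw [sUnion_eq_biUnion, inter_iUnion₂]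
    exact hG.biUnion h
  intro h2
  refine ha ((h1.union h2).subset ?_)
  rw [inter_union_sdiff]

/-- Diagonalise against `A` with `univ` as the only test set. It is positive because `A` is
infinite: any member outside a finite subfamily is almost disjoint from its union. -/
theorem IsMAD.not_countable {A : Set (Set ℕ)} (hA : IsMAD A) : ¬ A.Countable := by
  intro hc
  obtain ⟨B, hB, hBu⟩ := exists_almostDisjoint_hitting hc (countable_singleton Set.univ)
  have hinf : B.Infinite := by
    rw [← inter_univ B]
    refine hBu Set.univ rfl fun G hGA hG => ?_
    obtain ⟨a, ha, haG⟩ := hA.infinite.exists_notMem_finite hG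
    refine (sdiff_sUnion_infinite (hA.infinite_mem a ha) hG fun g hg => ?_).mono
      (sdiff_subset_sdiff_left (subset_univ a))
    exact hA.almostDisjoint a ha g (hGA hg) fun h => haG (h ▸ hg)
  obtain ⟨a, ha, h⟩ := hA.maximal B hinf
  rw [inter_comm] at h
  exact h (hB a ha)

theorem almostDisjointnessNumber_eq_of_exists {A : Set (Set ℕ)} (hA : IsMAD A)
    (hc : #A ≤ ℵ_ 1) : almostDisjointnessNumber = ℵ_ 1 := by
  have key : ∀ B : Set (Set ℕ), IsMAD B → ℵ_ 1 ≤ #B := fun B hB => by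
    rw [← not_lt, lt_aleph_one_iff_countable, le_aleph0_iff_set_countable]
    exact hB.not_countable
  refine le_antisymm ?_ (le_csInf ⟨_, A, hA, rfl⟩ ?_)
  · exact csInf_le' ⟨A, hA, le_antisymm hc (key A hA)⟩
  · rintro _ ⟨B, hB, rfl⟩
    exact key B hB

/-- The columns of a partition of `ℕ` into infinitely many infinite sets. -/
def column (n : ℕ) : Set ℕ := {m | (Nat.unpair m).1 = n}

theorem column_infinite (n : ℕ) : (column n).Infinite := by
  refine infinite_of_injective_forall_mem (f := fun k => Nat.pair n k) (fun a b h => ?_) fun k => ?_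
  · exact (Nat.pair_eq_pair.1 h).2
  · simp [column]

theorem column_inter {m n : ℕ} (h : m ≠ n) : column m ∩ column n = ∅ := by
  ext k
  simp only [column, mem_inter_iff, mem_ofPred_eq, mem_empty_iff_false, iff_false]
  rintro ⟨rfl, h2⟩
  exact h h2

theorem column_injective : Function.Injective column := by
  intro m n h
  by_contra hne
  have h1 := column_inter hne
  rw [← h, inter_self] at h1
  exact (column_infinite m) (h1 ▸ finite_empty)

/-! ### Well-founded recursion with side conditions -/

/-- A value is only guaranteed when all earlier choices were correct, so the recursion uses
`Classical.epsilon` unconditionally and correctness is proved afterwards by induction. -/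
theorem exists_recursive_function {α : Type*} [Nonempty α]
    (P : ∀ ζ : Ordinal.{u}, (Iio ζ → α) → α → Prop)
    (h : ∀ (ζ : Ordinal.{u}) (g : Iio ζ → α),
      (∀ ξ : Iio ζ, P ξ (fun η => g ⟨η.1, mem_Iio.2 (lt_trans (mem_Iio.1 η.2) (mem_Iio.1 ξ.2))⟩)
        (g ξ)) → ∃ a, P ζ g a) :
    ∃ f : Ordinal.{u} → α, ∀ ζ, P ζ (fun ξ => f ξ) (f ζ) := by
  let step : ∀ ζ : Ordinal.{u}, (∀ ξ : Ordinal.{u}, ξ < ζ → α) → α := fun ζ g =>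
    Classical.epsilon (P ζ fun ξ => g ξ.1 ξ.2)
  let f : Ordinal.{u} → α := WellFounded.fix Ordinal.lt_wf step
  have hf : ∀ ζ, f ζ = Classical.epsilon (P ζ fun ξ => f ξ) := fun ζ =>
    WellFounded.fix_eq Ordinal.lt_wf step ζ
  refine ⟨f, fun ζ => ?_⟩
  induction ζ using WellFoundedLT.induction with
  | ind ζ ih =>
    rw [hf ζ]
    exact Classical.epsilon_spec (h ζ (fun ξ => f ξ) fun ξ => ih ξ.1 ξ.2)

/-! ### Square sequences -/

theorem typeLT_inter_Iio_lt {C : Set Ordinal.{u}} {β : Ordinal.{u}} (h : β ∈ C) :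
    typeLT (C ∩ Iio β : Set Ordinal.{u}) < typeLT C := by
  rw [type_lt_iff]
  exact ⟨{
    toFun := fun x => ⟨x.1, x.2.1⟩
    inj' := fun x y hxy => Subtype.ext (Subtype.mk.inj hxy)
    map_rel_iff' := Iff.rfl
    top := ⟨β, h⟩
    mem_range_iff_rel' := fun x =>
      ⟨by rintro ⟨y, rfl⟩; exact y.2.2, fun hx => ⟨⟨x.1, x.2, hx⟩, rfl⟩⟩ }⟩

namespace IsSquareSeq

variable {C : Ordinal.{u} → Set Ordinal.{u}} {δ β γ : Ordinal.{u}}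

/-- The accumulation points of `C δ` below `δ`. -/
def acc (C : Ordinal.{u} → Set Ordinal.{u}) (δ : Ordinal.{u}) : Set Ordinal.{u} :=
  {β | β < δ ∧ AccPt β (𝓟 (C δ))}

theorem eq_inter (hC : IsSquareSeq C) (hδ : δ < ω_ 2) (hδl : Order.IsSuccLimit δ)
    (h : β ∈ acc C δ) : C β = C δ ∩ Iio β := hC.coherent δ hδ hδl β h.1 h.2

theorem mem_of_mem_acc (hC : IsSquareSeq C) (hδ : δ < ω_ 2) (hδl : Order.IsSuccLimit δ)
    (h : β ∈ acc C δ) : β ∈ C δ := hC.closed δ hδ hδl β h.1 h.2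

/-- By coherence `C β` and `C δ` agree below `β`, and being a limit point at `γ` depends only on
what lies below `γ`. -/
theorem mem_acc_of_lt (hC : IsSquareSeq C) (hδ : δ < ω_ 2) (hδl : Order.IsSuccLimit δ)
    (hβ : β ∈ acc C δ) (hγ : γ ∈ acc C δ) (h : γ < β) : γ ∈ acc C β := by
  refine ⟨h, ?_⟩
  have h1 := hγ.2
  rw [hC.eq_inter hδ hδl hβ]
  rw [SuccOrder.accPt_principal] at h1 ⊢
  refine ⟨h1.1, fun b hb => ?_⟩
  obtain ⟨c, hc, hbc⟩ := h1.2 b hb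
  exact ⟨c, ⟨hc, hbc.2.trans h⟩, hbc⟩

theorem acc_subset_acc (hC : IsSquareSeq C) (hδ : δ < ω_ 2) (hδl : Order.IsSuccLimit δ)
    (hβ : β ∈ acc C δ) : acc C β ⊆ acc C δ := by
  intro γ hγ
  refine ⟨hγ.1.trans hβ.1, hγ.2.mono (monotone_principal ?_)⟩
  rw [hC.eq_inter hδ hδl hβ]
  exact inter_subset_left

theorem typeLT_lt_of_lt (hC : IsSquareSeq C) (hδ : δ < ω_ 2) (hδl : Order.IsSuccLimit δ)
    (hβ : β ∈ acc C δ) (hγ : γ ∈ acc C δ) (h : γ < β) : typeLT (C γ) < typeLT (C β) := by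
  have h1 : C γ = C β ∩ Iio γ := by
    rw [hC.eq_inter hδ hδl hβ, hC.eq_inter hδ hδl hγ, inter_assoc]
    congr 1
    ext x
    exact ⟨fun hx => ⟨lt_trans hx h, hx⟩, fun hx => hx.2⟩
  rw [h1]
  refine typeLT_inter_Iio_lt ?_
  rw [hC.eq_inter hδ hδl hβ]
  exact ⟨hC.mem_of_mem_acc hδ hδl hγ, h⟩

theorem typeLT_lt_omega_one (hC : IsSquareSeq C) (hδ : δ < ω_ 2) (hδl : Order.IsSuccLimit δ)
    (hβ : β ∈ acc C δ) : typeLT (C β) < ω_ 1 := by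
  rw [hC.eq_inter hδ hδl hβ]
  exact (typeLT_inter_Iio_lt (hC.mem_of_mem_acc hδ hδl hβ)).trans_le (hC.type_le δ hδ hδl)

theorem countable_of_mem_acc (hC : IsSquareSeq C) (hδ : δ < ω_ 2) (hδl : Order.IsSuccLimit δ)
    (hβ : β ∈ acc C δ) : (C β).Countable := by
  have := hC.typeLT_lt_omega_one hδ hδl hβ
  rw [← ord_aleph, lt_ord, card_type] at this
  rw [← le_aleph0_iff_set_countable, ← lt_aleph_one_iff_countable]
  exact this

/-- The supremum of an increasing `ω`-sequence in `C δ` is a limit point, and it stays below `δ`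
since `δ` has uncountable cofinality. -/
theorem exists_mem_acc_gt (hC : IsSquareSeq C) (hδ : δ < ω_ 2) (hδl : Order.IsSuccLimit δ)
    (hcof : ∀ X : Set Ordinal.{u}, X ⊆ Iio δ → X.Countable → ∃ b < δ, ∀ x ∈ X, x < b)
    (hγ : γ < δ) : ∃ β ∈ acc C δ, γ < β := by
  have hnext : ∀ x : C δ, ∃ y : C δ, x.1 < y.1 := fun x => by
    obtain ⟨y, hy, hxy⟩ := hC.unbounded δ hδ hδl x (hC.subset δ hδ hδl x.2)
    exact ⟨⟨y, hy⟩, hxy⟩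
  choose nx hnx using hnext
  obtain ⟨c, hc, hγc⟩ := hC.unbounded δ hδ hδl γ hγ
  let s : ℕ → C δ := fun n => nx^[n] ⟨c, hc⟩
  have hs : ∀ n, (s n).1 < (s (n + 1)).1 := fun n => by
    change _ < (nx^[n + 1] ⟨c, hc⟩).1
    rw [Function.iterate_succ_apply']
    exact hnx _
  let b : Ordinal.{u} := ⨆ n, (s n).1
  have hsb : ∀ n, (s n).1 < b := fun n => (hs n).trans_le (Ordinal.le_iSup (fun n => (s n).1) _)
  obtain ⟨b', hb', hbb'⟩ := hcof (range fun n => (s n).1)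
    (by rintro _ ⟨n, rfl⟩; exact hC.subset δ hδ hδl (s n).2) (countable_range _)
  have hbδ : b < δ := lt_of_le_of_lt (Ordinal.iSup_le fun n => (hbb' _ ⟨n, rfl⟩).le) hb'
  refine ⟨b, ⟨hbδ, ?_⟩, hγc.trans (hsb 0)⟩
  rw [SuccOrder.accPt_principal]
  refine ⟨fun h => h.not_lt (hsb 0), ?_⟩
  intro a ha
  obtain ⟨n, hn⟩ := Ordinal.lt_iSup_iff.1 ha
  exact ⟨s n, (s n).2, hn, hsb n⟩

/-- The order type of `C β` is strictly increasing in `β ∈ acc C δ`. If the conclusion failed, all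
these types for `β ∈ S` would lie below one countable ordinal, and `S` would be countable. -/
theorem exists_mem_gt_of_not_countable (hC : IsSquareSeq C) (hδ : δ < ω_ 2)
    (hδl : Order.IsSuccLimit δ)
    (hcof : ∀ X : Set Ordinal.{u}, X ⊆ Iio δ → X.Countable → ∃ b < δ, ∀ x ∈ X, x < b)
    (hγ : γ < δ) {ν : Ordinal.{u + 1}} (hν : ν < ω_ 1) {S : Set Ordinal.{u}} (hS : S ⊆ acc C δ)
    (hSc : ¬ S.Countable) : ∃ β ∈ S, γ < β ∧ ν < typeLT (C β) := by
  by_contra! hcon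
  obtain ⟨γ', hγ', hγγ'⟩ := hC.exists_mem_acc_gt hδ hδl hcof hγ
  have hτ := hC.typeLT_lt_omega_one hδ hδl hγ'
  have hinj : InjOn (fun β => typeLT (C β)) S := by
    intro a ha b hb hab
    rcases lt_trichotomy a b with h | h | h
    · exact absurd hab (hC.typeLT_lt_of_lt hδ hδl (hS hb) (hS ha) h).ne
    · exact h
    · exact absurd hab (hC.typeLT_lt_of_lt hδ hδl (hS ha) (hS hb) h).ne'
  have hlim : Order.IsSuccLimit (ω_ 1 : Ordinal.{u + 1}) := isSuccLimit_omega 1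
  refine hSc (countable_of_injective_of_countable_image hinj
    ((countable_Iio_of_lt_omega_one (hlim.succ_lt (max_lt hν hτ))).mono ?_))
  rintro _ ⟨β, hβ, rfl⟩
  change typeLT (C β) < Order.succ (max ν (typeLT (C γ')))
  rw [Order.lt_succ_iff]
  by_cases h : γ < β
  · exact (hcon β hβ h).trans (le_max_left _ _)
  · have hlt : β < γ' := (not_lt.1 h).trans_lt hγγ'
    exact (hC.typeLT_lt_of_lt hδ hδl hγ' (hS hβ) hlt).le.trans (le_max_right _ _)

theorem acc_not_countable (hC : IsSquareSeq C) (hδ : δ < ω_ 2) (hδl : Order.IsSuccLimit δ)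
    (hcof : ∀ X : Set Ordinal.{u}, X ⊆ Iio δ → X.Countable → ∃ b < δ, ∀ x ∈ X, x < b) :
    ¬ (acc C δ).Countable := by
  intro h
  obtain ⟨b, hb, hlt⟩ := hcof (acc C δ) (fun β hβ => hβ.1) h
  obtain ⟨β, hβ, hbβ⟩ := hC.exists_mem_acc_gt hδ hδl hcof hb
  exact lt_asymm hbβ (hlt β hβ)

end IsSquareSeq

end SepIDP

namespace SepIDP

/-! ### Towers of good models -/

variable {χ : Cardinal.{u}} {C : Ordinal.{u} → Set Ordinal.{u}}

/-- The indices live in universe `u + 1` because they are compared with `typeLT (C ζ)`, the order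
type of a set of ordinals of universe `u`. -/
theorem exists_enumeration {K : Set ZFSet.{u}} (hK : #K ≤ ℵ_ 1) :
    ∃ e : Ordinal.{u + 1} → Set ℕ, ∀ s, setCode s ∈ K → ∃ ν < ω_ 1, e ν = s := by
  rw [← Cardinal.lift_le.{u + 2}, lift_aleph, Ordinal.lift_one, ← mk_Iio_omega_one.{u + 1},
    ← lift_id'.{u + 1, u + 2} #(Iio (ω_ 1 : Ordinal.{u + 1})), lift_mk_le'] at hK
  obtain ⟨g⟩ := hK
  let o : Set ℕ → Ordinal.{u + 1} := fun s =>
    open Classical in if h : setCode s ∈ K then (g ⟨_, h⟩).1 else 0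
  refine ⟨fun ν => open Classical in
    if h : ∃ s, setCode s ∈ K ∧ o s = ν then h.choose else ∅, fun s hs => ⟨o s, ?_, ?_⟩⟩
  · simp only [o, dif_pos hs]
    exact (g ⟨_, hs⟩).2
  · have h : ∃ t, setCode t ∈ K ∧ o t = o s := ⟨s, hs, rfl⟩
    simp only [dif_pos h]
    obtain ⟨h1, h2⟩ := h.choose_spec
    generalize h.choose = t at h1 h2
    simp only [o, dif_pos hs, dif_pos h1] at h2
    exact setCode_injective (Subtype.mk.inj (g.injective (Subtype.ext h2)))

/-- An enumeration of the sets of natural numbers coded in `K`. -/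
noncomputable def enumeration (K : Set ZFSet.{u}) : Ordinal.{u + 1} → Set ℕ :=
  Classical.epsilon fun e => ∀ s, setCode s ∈ K → ∃ ν < ω_ 1, e ν = s

theorem enumeration_spec {K : Set ZFSet.{u}} (hK : #K ≤ ℵ_ 1) {s : Set ℕ} (hs : setCode s ∈ K) :
    ∃ ν < ω_ 1, enumeration K ν = s :=
  Classical.epsilon_spec (exists_enumeration hK) s hs

/-- The sets from which the `ζ`-th set of the family is to be almost disjoint. -/
def base (C : Ordinal.{u} → Set Ordinal.{u}) (ζ : Ordinal.{u}) (A : Iio ζ → Set ℕ) :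
    Set (Set ℕ) :=
  range column ∪ A '' {γ | γ.1 ∈ IsSquareSeq.acc C ζ}

/-- The sets that the `ζ`-th set of the family is to meet. -/
noncomputable def tests (C : Ordinal.{u} → Set Ordinal.{u}) (ζ : Ordinal.{u})
    (K : Iio ζ → Set ZFSet.{u}) : Set (Set ℕ) :=
  insert Set.univ {s | ∃ ξ : Iio ζ, ξ.1 ∈ C ζ ∧ ∃ ν < typeLT (C ζ), enumeration (K ξ) ν = s}

theorem base_countable {ζ : Ordinal.{u}} (h : (IsSquareSeq.acc C ζ).Countable)
    (A : Iio ζ → Set ℕ) : (base C ζ A).Countable :=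
  (countable_range _).union ((h.preimage Subtype.val_injective).image _)

theorem tests_countable {ζ : Ordinal.{u}} (h : (C ζ).Countable)
    (K : Iio ζ → Set ZFSet.{u}) : (tests C ζ K).Countable := by
  refine Countable.insert _ ?_
  have h1 : (Iio (typeLT (C ζ))).Countable := by
    refine countable_Iio_of_lt_omega_one ?_
    rw [← ord_aleph, lt_ord, card_type, lt_aleph_one_iff_countable, le_aleph0_iff_set_countable]
    exact h
  have h2 : {ξ : Iio ζ | ξ.1 ∈ C ζ}.Countable := h.preimage Subtype.val_injective
  refine ((h2.prod h1).image fun q => enumeration (K q.1) q.2).mono ?_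
  rintro _ ⟨ξ, hξ, ν, hν, rfl⟩
  exact ⟨(ξ, ν), ⟨hξ, hν⟩, rfl⟩

/-- The requirements on the `ζ`-th model `N` and the `ζ`-th set `B` of a tower. -/
structure TowerStep (χ : Cardinal.{u}) (C : Ordinal.{u} → Set Ordinal.{u}) (ζ : Ordinal.{u})
    (K : Iio ζ → Set ZFSet.{u}) (A : Iio ζ → Set ℕ) (N : Set ZFSet.{u}) (B : Set ℕ) : Prop where
  good : N ∈ goodModels χ
  sep : LeSep ZFSet.omega ((ZFSet.omega.powerset : Set ZFSet.{u}) ∩ N)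
  ordinal_mem : ∀ ν : Ordinal.{u}, ν < ω_ 1 → ν.toZFSet ∈ N
  subset : ∀ ξ, K ξ ⊆ N
  code_mem : ∀ ξ, toZF (K ξ) ∈ N
  tail_mem : ∀ n : ℕ, setCode (B \ Iio n) ∈ N
  pair_mem : ZFSet.pair ZFSet.omega.powerset (inclusionRel ZFSet.omega.powerset) ∈ N
  almostDisjoint : (C ζ).Countable → (IsSquareSeq.acc C ζ).Countable →
    ∀ f ∈ base C ζ A, (B ∩ f).Finite
  hitting : (C ζ).Countable → (IsSquareSeq.acc C ζ).Countable →
    ∀ s ∈ tests C ζ K, (∀ G ⊆ base C ζ A, G.Finite → (s \ ⋃₀ G).Infinite) → (B ∩ s).Infinite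

/-- `SEP(𝒫(ω))` for a fixed `χ`. -/
def SEPAt (χ : Cardinal.{u}) : Prop :=
  ∀ Y : Set ZFSet.{u}, Y ⊆ H χ → #Y = ℵ_ 1 →
    ∃ M ∈ goodModels χ, Y ⊆ M ∧ LeSep ZFSet.omega ((ZFSet.omega.powerset : Set ZFSet.{u}) ∩ M)

theorem SEPAt.exists_model (hsep : SEPAt χ) (hχ : χ.IsRegular) (hχ2 : ℵ_ 2 < χ)
    {Y : Set ZFSet.{u}} (hY : Y ⊆ H χ) (hYc : #Y ≤ ℵ_ 1) :
    ∃ M ∈ goodModels χ, Y ⊆ M ∧ LeSep ZFSet.omega ((ZFSet.omega.powerset : Set ZFSet.{u}) ∩ M) ∧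
      ∀ ν : Ordinal.{u}, ν < ω_ 1 → ν.toZFSet ∈ M := by
  let O : Set ZFSet.{u} := Ordinal.toZFSet '' Iio (ω_ 1)
  have hO : #O = ℵ_ 1 := by
    rw [mk_image_eq Ordinal.toZFSet_injective, mk_Iio_omega_one]
  have hOH : O ⊆ H χ := by
    rintro _ ⟨ν, hν, rfl⟩
    refine toZFSet_mem_H hχ (lt_trans ?_ hχ2)
    rw [← lt_ord, ord_aleph]
    refine lt_trans hν (omega_lt_omega.2 one_lt_two)
  obtain ⟨M, hM, hYM, hMs⟩ := hsep (Y ∪ O) (union_subset hY hOH) (by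
    refine le_antisymm ((mk_union_le _ _).trans ?_) ?_
    · rw [hO]
      exact (add_le_add_left hYc _).trans (add_eq_self (aleph0_le_aleph 1)).le
    · rw [← hO]
      exact mk_le_mk_of_subset subset_union_right)
  exact ⟨M, hM, subset_union_left.trans hYM, hMs,
    fun ν hν => hYM (Or.inr ⟨ν, hν, rfl⟩)⟩

theorem goodModels.subset_H {M : Set ZFSet.{u}} (hM : M ∈ goodModels χ) : M ⊆ H χ :=
  hM.1.subset_H

theorem goodModels.mk_le {M : Set ZFSet.{u}} (hM : M ∈ goodModels χ) :
    #M ≤ lift.{u + 1} (ℵ_ 1 : Cardinal.{u}) := by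
  rw [hM.2.1, lift_aleph_one']

theorem aleph_one_lt_of_aleph_two_lt (h : ℵ_ 2 < χ) : ℵ_ 1 < χ :=
  (lt_aleph_two_iff.2 le_rfl).trans h

theorem goodModels.toZF_mem_H {M : Set ZFSet.{u}} (hM : M ∈ goodModels χ) (hχ : χ.IsRegular)
    (hχ2 : ℵ_ 2 < χ) : toZF M ∈ H χ :=
  SepIDP.toZF_mem_H hχ (goodModels.subset_H hM) ((goodModels.mk_le hM).trans_lt
    (lift_lt.2 (aleph_one_lt_of_aleph_two_lt hχ2)))

theorem exists_towerStep (hsep : SEPAt χ) (hχ : χ.IsRegular) (hχ2 : ℵ_ 2 < χ)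
    (hχc : 2 ^ (ℵ₀ : Cardinal.{u}) < χ) {ζ : Ordinal.{u}} (hζ : ζ < ω_ 2)
    (K : Iio ζ → Set ZFSet.{u}) (A : Iio ζ → Set ℕ) (hK : ∀ ξ, K ξ ∈ goodModels χ) :
    ∃ N B, TowerStep χ C ζ K A N B := by
  obtain ⟨B, hB⟩ : ∃ B : Set ℕ, (C ζ).Countable → (IsSquareSeq.acc C ζ).Countable →
      (∀ f ∈ base C ζ A, (B ∩ f).Finite) ∧ ∀ s ∈ tests C ζ K,
        (∀ G ⊆ base C ζ A, G.Finite → (s \ ⋃₀ G).Infinite) → (B ∩ s).Infinite := by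
    by_cases h : (C ζ).Countable ∧ (IsSquareSeq.acc C ζ).Countable
    · obtain ⟨B, hB⟩ := exists_almostDisjoint_hitting (base_countable h.2 A)
        (tests_countable h.1 K)
      exact ⟨B, fun _ _ => hB⟩
    -- Nothing is demanded at such a stage. Stages in `acc C δ`, the only ones used in the final
    -- family, have countable `C ζ` because the order type of `C δ` is at most `ω₁`.
    · exact ⟨∅, fun h1 h2 => absurd ⟨h1, h2⟩ h⟩
  let p : ZFSet.{u} := ZFSet.pair ZFSet.omega.powerset (inclusionRel ZFSet.omega.powerset)
  let Y : Set ZFSet.{u} := (⋃ ξ, insert (toZF (K ξ)) (K ξ)) ∪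
    insert p (range fun n : ℕ => setCode (B \ Iio n))
  have hYH : Y ⊆ H χ := by
    refine union_subset (iUnion_subset fun ξ => insert_subset ?_ ?_) (insert_subset ?_ ?_)
    · exact goodModels.toZF_mem_H (hK ξ) hχ hχ2
    · exact goodModels.subset_H (hK ξ)
    · have := powerset_omega_mem_H hχ hχc
      exact pair_mem_H hχ this (inclusionRel_mem_H hχ this)
    · rintro _ ⟨n, rfl⟩
      exact setCode_mem_H hχ ((cantor _).trans hχc) _
  have h1 : (ℵ₀ : Cardinal.{u + 1}) ≤ ℵ_ 1 := aleph0_le_aleph 1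
  have hYc : #Y ≤ ℵ_ 1 := by
    refine (mk_union_le _ _).trans (add_le_of_le h1 ?_ ?_)
    · refine (mk_iUnion_le _).trans ?_
      rw [← mul_eq_self h1]
      refine mul_le_mul' (mk_Iio_le_aleph_one hζ) (ciSup_le' fun ξ => ?_)
      refine mk_insert_le.trans (add_le_of_le h1 (hK ξ).2.1.le (one_lt_aleph0.le.trans h1))
    · refine le_trans (le_aleph0_iff_set_countable.2 ?_) h1
      exact (countable_range _).insert _
  obtain ⟨N, hN, hYN, hNs, hNo⟩ := hsep.exists_model hχ hχ2 hYH hYc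
  refine ⟨N, B, hN, hNs, hNo, fun ξ => ?_, fun ξ => ?_, fun n => ?_, ?_, fun h h' => (hB h h').1,
    fun h h' => (hB h h').2⟩
  · exact fun z hz => hYN (Or.inl (mem_iUnion.2 ⟨ξ, Or.inr hz⟩))
  · exact hYN (Or.inl (mem_iUnion.2 ⟨ξ, Or.inl rfl⟩))
  · exact hYN (Or.inr (Or.inr ⟨n, rfl⟩))
  · exact hYN (Or.inr (Or.inl rfl))

/-- A tower of models `K` with sets `A` of natural numbers. -/
def IsTower (χ : Cardinal.{u}) (C : Ordinal.{u} → Set Ordinal.{u})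
    (K : Ordinal.{u} → Set ZFSet.{u}) (A : Ordinal.{u} → Set ℕ) : Prop :=
  ∀ ζ < ω_ 2, TowerStep χ C ζ (fun ξ => K ξ) (fun ξ => A ξ) (K ζ) (A ζ)

theorem exists_isTower (C : Ordinal.{u} → Set Ordinal.{u}) (hsep : SEPAt χ) (hχ : χ.IsRegular)
    (hχ2 : ℵ_ 2 < χ) (hχc : 2 ^ (ℵ₀ : Cardinal.{u}) < χ) : ∃ K A, IsTower χ C K A := by
  obtain ⟨f, hf⟩ := exists_recursive_function (α := Set ZFSet.{u} × Set ℕ)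
    (fun ζ g a => ζ < ω_ 2 → TowerStep χ C ζ (fun ξ => (g ξ).1) (fun ξ => (g ξ).2) a.1 a.2)
    (fun ζ g hg => by
      by_cases hζ : ζ < ω_ 2
      · obtain ⟨N, B, h⟩ := exists_towerStep (C := C) hsep hχ hχ2 hχc hζ (fun ξ => (g ξ).1)
          (fun ξ => (g ξ).2) fun ξ => (hg ξ (lt_trans ξ.2 hζ)).good
        exact ⟨(N, B), fun _ => h⟩
      · exact ⟨(∅, ∅), fun h => absurd h hζ⟩)
  exact ⟨fun ζ => (f ζ).1, fun ζ => (f ζ).2, hf⟩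

namespace IsTower

variable {K : Ordinal.{u} → Set ZFSet.{u}} {A : Ordinal.{u} → Set ℕ} {ξ ζ : Ordinal.{u}}

/-- The union of the models of a tower. -/
def union (K : Ordinal.{u} → Set ZFSet.{u}) : Set ZFSet.{u} :=
  ⋃ ζ : Iio (ω_ 2 : Ordinal.{u}), K ζ

theorem mem_union {x : ZFSet.{u}} : x ∈ union K ↔ ∃ ζ < ω_ 2, x ∈ K ζ := by
  simp [union]

theorem mono (h : IsTower χ C K A) (hζ : ζ < ω_ 2) (hξζ : ξ ≤ ζ) : K ξ ⊆ K ζ := by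
  rcases hξζ.eq_or_lt with rfl | hlt
  · exact subset_rfl
  · exact (h ζ hζ).subset ⟨ξ, hlt⟩

theorem code_mem (h : IsTower χ C K A) (hζ : ζ < ω_ 2) (hξζ : ξ < ζ) : toZF (K ξ) ∈ K ζ :=
  (h ζ hζ).code_mem ⟨ξ, hξζ⟩

theorem isSuccLimit_omega_two : Order.IsSuccLimit (ω_ 2 : Ordinal.{u}) := isSuccLimit_omega 2

theorem code_mem_union (h : IsTower χ C K A) (hζ : ζ < ω_ 2) : toZF (K ζ) ∈ union K :=
  mem_union.2 ⟨Order.succ ζ, isSuccLimit_omega_two.succ_lt hζ,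
    h.code_mem (isSuccLimit_omega_two.succ_lt hζ) (Order.lt_succ ζ)⟩

/-- By regularity of `ω₂`, the stages at which the members of `X` appear are bounded. -/
theorem exists_subset (h : IsTower χ C K A) {X : Set ZFSet.{u}} (hX : X ⊆ union K)
    (hXc : #X ≤ ℵ_ 1) : ∃ ζ < ω_ 2, X ⊆ K ζ := by
  have hr : ∀ x : X, ∃ ζ < ω_ 2, x.1 ∈ K ζ := fun x => mem_union.1 (hX x.2)
  choose r hr hrK using hr
  obtain ⟨b, hb, hlt⟩ := exists_lt_omega_two (X := range r)
    (by rintro _ ⟨x, rfl⟩; exact hr x) (mk_range_le.trans hXc)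
  exact ⟨b, hb, fun x hx => h.mono hb (hlt _ ⟨⟨x, hx⟩, rfl⟩).le (hrK ⟨x, hx⟩)⟩

theorem isElemSubmodel_union (h : IsTower χ C K A) : IsElemSubmodel χ (union K) := by
  have : Nonempty (Iio (ω_ 2 : Ordinal.{u})) := ⟨⟨0, omega_pos 2⟩⟩
  refine isElemSubmodel_iUnion (fun ζ : Iio (ω_ 2 : Ordinal.{u}) => K ζ)
    (fun ζ => (h ζ.1 ζ.2).good.1) ?_
  exact fun ξ ζ => ⟨max ξ ζ, h.mono (max ξ ζ).2 (le_max_left ξ ζ),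
    h.mono (max ξ ζ).2 (le_max_right ξ ζ)⟩

/-- For the lower bound, the codes of the models are distinct members of the union: an earlier code
belongs to a later model, and no set belongs to itself. -/
theorem mk_union (h : IsTower χ C K A) : #(union K) = ℵ_ 2 := by
  have h2 : (ℵ₀ : Cardinal.{u + 1}) ≤ ℵ_ 2 := aleph0_le_aleph 2
  refine le_antisymm ?_ ?_
  · refine (mk_iUnion_le _).trans ?_
    rw [← mul_eq_self h2]
    refine mul_le_mul' mk_Iio_omega_two.le (ciSup_le' fun ξ => ?_)
    rw [(h ξ.1 ξ.2).good.2.1]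
    exact (lt_aleph_two_iff.2 le_rfl).le
  · rw [← mk_Iio_omega_two]
    refine mk_le_of_injective (f := fun ζ : Iio (ω_ 2 : Ordinal.{u}) =>
      (⟨toZF (K ζ), h.code_mem_union ζ.2⟩ : union K)) fun ξ ζ hξζ => ?_
    have hne : ∀ ξ ζ : Iio (ω_ 2 : Ordinal.{u}), ξ < ζ → toZF (K ξ) ≠ toZF (K ζ) := by
      intro ξ ζ hlt heq
      have h3 := h.code_mem ζ.2 hlt
      rw [heq, ← mem_toZF (goodModels.mk_le (h ζ.1 ζ.2).good)] at h3
      exact ZFSet.mem_irrefl _ h3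
    have heq : toZF (K ξ) = toZF (K ζ) := Subtype.mk.inj hξζ
    rcases lt_trichotomy ξ ζ with hlt | hlt | hlt
    · exact absurd heq (hne _ _ hlt)
    · exact hlt
    · exact absurd heq.symm (hne _ _ hlt)

theorem internallyCofinal_union (h : IsTower χ C K A) : InternallyCofinal (ℵ_ 1) (union K) := by
  intro X hX hXc
  obtain ⟨ζ, hζ, hXζ⟩ := h.exists_subset hX hXc.le
  refine ⟨toZF (K ζ), h.code_mem_union hζ, ?_⟩
  rw [coe_toZF (goodModels.mk_le (h ζ hζ).good)]
  exact ⟨fun x hx => mem_union.2 ⟨ζ, hζ, hx⟩, (h ζ hζ).good.2.1, hXζ⟩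

/-- The IDP gives at most `ℵ₁` sets cofinal among the subsets of `s` in the union, and these all
appear by a single stage. -/
theorem exists_interpolation (h : IsTower χ C K A)
    (hidp : LeCard (ℵ_ 2) (fun p q => ZFSet.pair p q ∈ inclusionRel ZFSet.omega.{u}.powerset)
      ((ZFSet.omega.{u}.powerset : Set ZFSet.{u}) ∩ union K) (ZFSet.omega.{u}.powerset))
    (s : Set ℕ) : ∃ ζ < ω_ 2, ∀ t : Set ℕ, setCode t ∈ union K → t ⊆ s →
      ∃ c : Set ℕ, setCode c ∈ K ζ ∧ t ⊆ c ∧ c ⊆ s := by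
  obtain ⟨D, hD, hDc, hDcof⟩ := (hidp.2 (setCode s) (setCode_mem_powerset s)).1
  obtain ⟨ζ, hζ, hDζ⟩ := h.exists_subset (fun x hx => (hD hx).1.2) (lt_aleph_two_iff.1 hDc)
  refine ⟨ζ, hζ, fun t ht hts => ?_⟩
  obtain ⟨c, hc, htc⟩ := hDcof (setCode t) ⟨setCode_mem_powerset t, ht⟩
    ((pair_mem_inclusionRel (setCode_mem_powerset t) (setCode_mem_powerset s)).2
      (setCode_subset_iff.2 hts))
  have hcs := (hD hc).2
  obtain ⟨c, rfl⟩ := mem_powerset_omega_iff.1 (hD hc).1.1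
  rw [pair_mem_inclusionRel (setCode_mem_powerset _) (setCode_mem_powerset _),
    setCode_subset_iff] at htc hcs
  exact ⟨c, hDζ hc, htc, hcs⟩

end IsTower

end SepIDP

namespace SepIDP

/-! ### The trace of a good model on `ω₂` -/

variable {χ : Cardinal.{u}} {M : Set ZFSet.{u}} {C : Ordinal.{u} → Set Ordinal.{u}}

/-- The function `a i ↦ b i` as a set of ordered pairs. -/
noncomputable def graph {ι : Type*} [Small.{u} ι] (a b : ι → ZFSet.{u}) : ZFSet.{u} :=
  ZFSet.range fun i => ZFSet.pair (a i) (b i)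

theorem IsElemSubmodel.apply_mem (hM : IsElemSubmodel χ M) (hχ : χ.IsRegular) {ι : Type*}
    [Small.{u} ι] {a b : ι → ZFSet.{u}} (ha : Function.Injective a) (hG : graph a b ∈ M) {i : ι}
    (hi : a i ∈ M) : b i ∈ M := by
  obtain ⟨y, hy, hp⟩ := hM.exists_pair_mem hχ hG hi ⟨b i, ZFSet.mem_range.2 ⟨i, rfl⟩⟩
  obtain ⟨j, hj⟩ := ZFSet.mem_range.1 hp
  obtain ⟨h1, h2⟩ := ZFSet.pair_inj.1 hj
  rw [ha h1] at h2
  rwa [h2]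

theorem graph_mem_H (hχ : χ.IsRegular) {ι : Type*} [Small.{u} ι] {a b : ι → ZFSet.{u}}
    (ha : ∀ i, a i ∈ H χ) (hb : ∀ i, b i ∈ H χ) (hι : #(Set.range a) < lift.{u + 1} χ)
    (hinj : Function.Injective a) : graph a b ∈ H χ := by
  refine range_mem_H hχ (fun i => pair_mem_H hχ (ha i) (hb i)) (lt_of_le_of_lt ?_ hι)
  have h1 : ∀ p : range fun i => ZFSet.pair (a i) (b i), ∃ i, ZFSet.pair (a i) (b i) = p.1 :=
    fun p => p.2
  choose f hf using h1
  refine mk_le_of_injective (f := fun p => (⟨a (f p), mem_range_self _⟩ : range a))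
    fun p q hpq => Subtype.ext ?_
  rw [← hf p, ← hf q, hinj (Subtype.mk.inj hpq)]

theorem toZFSet_mem_H_of_lt (hχ : χ.IsRegular) (hχ2 : ℵ_ 2 < χ) {α : Ordinal.{u}}
    (hα : α ≤ ω_ 2) : α.toZFSet ∈ H χ := by
  refine toZFSet_mem_H hχ (lt_of_le_of_lt ?_ hχ2)
  rw [← card_omega]
  exact Ordinal.card_le_card hα

/-- `htrans` makes `M ∩ ω₂` an initial segment, so it equals some `δ`, and `δ < ω₂` as `M` has size
`ℵ₁`. Internal cofinality for countable sets gives `δ` uncountable cofinality, which also makes it a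
limit. -/
theorem exists_trace (hM : M ∈ goodModels χ)
    (hord : ∀ ν : Ordinal.{u}, ν < ω_ 1 → ν.toZFSet ∈ M)
    (htwo : (ω_ 2 : Ordinal.{u}).toZFSet ∈ M)
    (htrans : ∀ α < ω_ 2, α.toZFSet ∈ M → ∀ β < α, β.toZFSet ∈ M) :
    ∃ δ < ω_ 2, Order.IsSuccLimit δ ∧ (∀ α < ω_ 2, α.toZFSet ∈ M ↔ α < δ) ∧
      ∀ X : Set Ordinal.{u}, X ⊆ Iio δ → X.Countable → ∃ b < δ, ∀ x ∈ X, x < b := by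
  let D : Set Ordinal.{u} := {α | α < ω_ 2 ∧ α.toZFSet ∈ M}
  obtain ⟨b, hb, hDb⟩ := exists_lt_omega_two (X := D) (fun α hα => hα.1) (by
    rw [← hM.2.1]
    exact mk_le_of_injective (f := fun α : D => (⟨α.1.toZFSet, α.2.2⟩ : M)) fun α β h =>
      Subtype.ext (Ordinal.toZFSet_injective (Subtype.mk.inj h)))
  let δ : Ordinal.{u} := sInf {α | α ∉ D}
  have hδD : δ ∉ D := csInf_mem (s := {α | α ∉ D}) ⟨b, fun h => lt_irrefl b (hDb b h)⟩
  have hδb : δ ≤ b := csInf_le' fun h => lt_irrefl b (hDb b h)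
  have hδ : δ < ω_ 2 := hδb.trans_lt hb
  have hlt : ∀ α < δ, α ∈ D := fun α hα => by
    by_contra h
    exact not_lt.2 (csInf_le' (s := {α | α ∉ D}) h) hα
  have hiff : ∀ α < ω_ 2, α.toZFSet ∈ M ↔ α < δ := by
    refine fun α hα => ⟨fun h => ?_, fun h => (hlt α h).2⟩
    by_contra hle
    rcases (not_lt.1 hle).eq_or_lt with heq | hlt'
    · exact hδD ⟨hδ, heq ▸ h⟩
    · exact hδD ⟨hδ, htrans α hα h δ hlt'⟩
  have hω : ω_ 1 < (ω_ 2 : Ordinal.{u}) := omega_lt_omega.2 one_lt_two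
  have hcof : ∀ X : Set Ordinal.{u}, X ⊆ Iio δ → X.Countable →
      ∃ b < δ, ∀ x ∈ X, x < b := by
    intro X hX hXc
    -- The natural numbers are added because internal cofinality speaks of sets of size exactly
    -- `ℵ₀`, while `X` may be finite.
    let X' : Set ZFSet.{u} := Ordinal.toZFSet '' (X ∪ range ((↑) : ℕ → Ordinal.{u}))
    have hX'M : X' ⊆ M := by
      rintro _ ⟨α, hα | ⟨n, rfl⟩, rfl⟩
      · exact (hlt α (hX hα)).2
      · exact hord _ ((natCast_lt_omega0 n).trans omega0_lt_omega_one)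
    have hX'c : #X' = ℵ₀ := by
      refine le_antisymm (le_aleph0_iff_set_countable.2
        ((hXc.union (countable_range _)).image _)) ?_
      rw [aleph0_le_mk_iff, Set.infinite_coe_iff]
      refine Set.Infinite.image Ordinal.toZFSet_injective.injOn (Set.Infinite.mono
        subset_union_right (infinite_range_of_injective Nat.cast_injective))
    obtain ⟨y, hyM, -, hyc, hX'y⟩ := hM.2.2 X' hX'M hX'c
    -- The cover `y ∈ M` is countable, so its ordinals are bounded in `ω₂`; elementarity then gives
    -- a bound inside `M`, that is, below `δ`.
    obtain ⟨c, hc, hcy⟩ := exists_lt_omega_two (X := {α | α < ω_ 2 ∧ α.toZFSet ∈ y})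
      (fun α hα => hα.1) (by
        refine le_trans ?_ (hyc.le.trans (aleph0_le_aleph 1))
        exact mk_le_of_injective (f := fun α : {α | α < ω_ 2 ∧ α.toZFSet ∈ y} =>
          (⟨α.1.toZFSet, α.2.2⟩ : (y : Set ZFSet.{u}))) fun α β h =>
            Subtype.ext (Ordinal.toZFSet_injective (Subtype.mk.inj h)))
    let φ : Fml := Fml.and (Fml.mem 2 0) (Fml.all 3 (Fml.imp (Fml.mem 3 1)
      (Fml.imp (Fml.mem 3 0) (Fml.mem 3 2))))
    have hφ : ∀ v : ℕ → H χ, φ.Sat v ↔ ((v 2 : ZFSet.{u}) ∈ (v 0 : ZFSet.{u}) ∧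
        ∀ w : H χ, w.1 ∈ (v 1 : ZFSet.{u}) → w.1 ∈ (v 0 : ZFSet.{u}) →
          w.1 ∈ (v 2 : ZFSet.{u})) := by
      intro v
      simp only [φ, Fml.sat_and, Fml.sat_all, Fml.sat_imp, Fml.sat_mem, Function.update_self,
        Function.update_of_ne, ne_eq, not_false_eq_true, show (0 : ℕ) ≠ 3 by norm_num,
        show (1 : ℕ) ≠ 3 by norm_num, show (2 : ℕ) ≠ 3 by norm_num]
    have htwoH := hM.1.subset_H htwo
    obtain ⟨z, hzM, hz⟩ := hM.1.exists_mem φ 2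
      (valuation ⟨_, htwoH⟩ ⟨y, hM.1.subset_H hyM⟩ ⟨_, htwoH⟩ ⟨_, htwoH⟩)
      (valuation_mem htwo hyM htwo htwo)
      ⟨⟨c.toZFSet, mem_H_of_mem (Ordinal.toZFSet_mem_toZFSet_iff.2 hc) htwoH⟩, by
        rw [hφ]
        refine ⟨Ordinal.toZFSet_mem_toZFSet_iff.2 hc, fun w hwy hw => ?_⟩
        obtain ⟨α, hα, hαw⟩ := Ordinal.mem_toZFSet_iff.1 hw
        change w.1 ∈ c.toZFSet
        rw [← hαw]
        exact Ordinal.toZFSet_mem_toZFSet_iff.2 (hcy α ⟨hα, by rw [hαw]; exact hwy⟩)⟩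
    rw [hφ] at hz
    obtain ⟨hz1, hz2⟩ := hz
    obtain ⟨e, he, hez⟩ := Ordinal.mem_toZFSet_iff.1 hz1
    replace hez : e.toZFSet = z.1 := hez
    refine ⟨e, (hiff e he).1 (by rw [hez]; exact hzM), fun x hx => ?_⟩
    have hxM := hlt x (hX hx)
    have hxz := hz2 ⟨x.toZFSet, hM.1.subset_H hxM.2⟩ (hX'y ⟨x, Or.inl hx, rfl⟩)
      (Ordinal.toZFSet_mem_toZFSet_iff.2 hxM.1)
    replace hxz : x.toZFSet ∈ z.1 := hxz
    rwa [← hez, Ordinal.toZFSet_mem_toZFSet_iff] at hxz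
  refine ⟨δ, hδ, ?_, hiff, hcof⟩
  have h0 : 0 < δ := (hiff 0 (omega_pos 2)).1 (hord 0 (omega_pos 1))
  rw [Order.isSuccLimit_iff, Order.isSuccPrelimit_iff_succ_lt]
  refine ⟨fun h => h.not_lt h0, fun x hx => ?_⟩
  obtain ⟨b, hb, hxb⟩ := hcof {x} (by rintro _ rfl; exact hx) (countable_singleton x)
  exact (Order.succ_le_of_lt (hxb x rfl)).trans_lt hb

/-- A function that enumerates each `α < ω₂` along `ω₁`. -/
theorem exists_surjections : ∃ k : Iio (ω_ 2 : Ordinal.{u}) → Iio (ω_ 1 : Ordinal.{u}) →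
    Ordinal.{u}, (∀ α ν, k α ν < ω_ 2) ∧ ∀ α, ∀ β < α.1, ∃ ν, k α ν = β := by
  have hg : ∀ α : Iio (ω_ 2 : Ordinal.{u}), Nonempty (Iio α.1 ↪ Iio (ω_ 1 : Ordinal.{u})) := by
    intro α
    have := mk_Iio_le_aleph_one α.2
    rwa [← mk_Iio_omega_one.{u}] at this
  refine ⟨fun α => Function.extend (hg α).some Subtype.val fun _ => 0, fun α ν => ?_,
    fun α β hβ => ⟨(hg α).some ⟨β, hβ⟩, ?_⟩⟩
  · by_cases h : ∃ β, (hg α).some β = ν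
    · obtain ⟨β, rfl⟩ := h
      exact ((hg α).some.injective.extend_apply _ _ _).trans_lt (lt_trans β.2 α.2)
    · exact (Function.extend_apply' _ _ _ h).trans_lt (omega_pos 2)
  · exact (hg α).some.injective.extend_apply _ _ _

/-- The functions under which `M` must be closed are sets in `H χ`, so SEP provides an `M` that has
them as elements. -/
theorem SEPAt.exists_closed_model (hsep : SEPAt χ) (A : Ordinal.{u} → Set ℕ)
    (hχ : χ.IsRegular) (hχ2 : ℵ_ 2 < χ) (hχc : 2 ^ (ℵ₀ : Cardinal.{u}) < χ)
    (f : Set ℕ → Ordinal.{u}) (hf : ∀ s, f s < ω_ 2) :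
    ∃ M ∈ goodModels χ, LeSep ZFSet.omega ((ZFSet.omega.powerset : Set ZFSet.{u}) ∩ M) ∧
      ∃ δ < ω_ 2, Order.IsSuccLimit δ ∧
        (∀ X : Set Ordinal.{u}, X ⊆ Iio δ → X.Countable → ∃ b < δ, ∀ x ∈ X, x < b) ∧
        (∀ s, setCode s ∈ M → f s < δ) ∧ ∀ β < δ, ∀ n : ℕ, setCode (A β \ Iio n) ∈ M := by
  obtain ⟨k, hk, hks⟩ := exists_surjections.{u}
  let o : Iio (ω_ 2 : Ordinal.{u}) → ZFSet.{u} := fun α => α.1.toZFSet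
  have ho : Function.Injective o := fun α β h => Subtype.ext (Ordinal.toZFSet_injective h)
  have hoH : ∀ α, o α ∈ H χ := fun α => toZFSet_mem_H_of_lt hχ hχ2 (mem_Iio.1 α.2).le
  have hoc : #(range o) < lift.{u + 1} χ := by
    refine mk_range_le.trans_lt ?_
    rw [mk_Iio_omega_two, ← lift_aleph_two]
    exact lift_lt.2 hχ2
  have hχ0 : ℵ₀ < χ := (cantor _).trans hχc
  -- One unary function for each `ν < ω₁`: together they list every `β < α`, so closure under all of
  -- them makes `M ∩ ω₂` an initial segment.
  let g₁ : Iio (ω_ 1 : Ordinal.{u}) → ZFSet.{u} := fun ν => graph o fun α => (k α ν).toZFSet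
  let g₂ : ℕ → ZFSet.{u} := fun n => graph o fun β => setCode (A β \ Iio n)
  let g₃ : ZFSet.{u} := graph setCode fun s => (f s).toZFSet
  let Y : Set ZFSet.{u} := range g₁ ∪ (range g₂ ∪ {g₃, (ω_ 2 : Ordinal.{u}).toZFSet})
  have hYH : Y ⊆ H χ := by
    refine union_subset ?_ (union_subset ?_ (insert_subset ?_ (singleton_subset_iff.2 ?_)))
    · rintro _ ⟨ν, rfl⟩
      exact graph_mem_H hχ hoH (fun α => toZFSet_mem_H_of_lt hχ hχ2 (hk α ν).le) hoc ho
    · rintro _ ⟨n, rfl⟩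
      exact graph_mem_H hχ hoH (fun β => setCode_mem_H hχ hχ0 _) hoc ho
    · refine graph_mem_H hχ (setCode_mem_H hχ hχ0)
        (fun s => toZFSet_mem_H_of_lt hχ hχ2 (hf s).le) ?_ setCode_injective
      rw [← coe_powerset_omega]
      exact mk_lt_of_mem_H (powerset_omega_mem_H hχ hχc)
    · exact toZFSet_mem_H_of_lt hχ hχ2 le_rfl
  have h1 : (ℵ₀ : Cardinal.{u + 1}) ≤ ℵ_ 1 := aleph0_le_aleph 1
  have hYc : #Y ≤ ℵ_ 1 := by
    refine (mk_union_le _ _).trans (add_le_of_le h1 ?_ ?_)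
    · exact mk_range_le.trans mk_Iio_omega_one.le
    · refine le_trans (le_aleph0_iff_set_countable.2 ?_) h1
      exact (countable_range _).union ((countable_singleton _).insert _)
  obtain ⟨M, hM, hYM, hMs, hord⟩ := hsep.exists_model hχ hχ2 hYH hYc
  have hg₁ : ∀ ν, g₁ ν ∈ M := fun ν => hYM (Or.inl ⟨ν, rfl⟩)
  have hg₂ : ∀ n, g₂ n ∈ M := fun n => hYM (Or.inr (Or.inl ⟨n, rfl⟩))
  have hg₃ : g₃ ∈ M := hYM (Or.inr (Or.inr (Or.inl rfl)))
  have htwo : (ω_ 2 : Ordinal.{u}).toZFSet ∈ M := hYM (Or.inr (Or.inr (Or.inr rfl)))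
  obtain ⟨δ, hδ, hδl, hiff, hcof⟩ := exists_trace hM hord htwo fun α hα hαM β hβ => by
    obtain ⟨ν, rfl⟩ := hks ⟨α, hα⟩ β hβ
    exact hM.1.apply_mem hχ ho (hg₁ ν) hαM
  refine ⟨M, hM, hMs, δ, hδ, hδl, hcof, fun s hs => ?_, fun β hβ n => ?_⟩
  · exact (hiff _ (hf s)).1 (hM.1.apply_mem hχ setCode_injective hg₃ hs)
  · exact hM.1.apply_mem hχ ho (hg₂ n) (i := ⟨β, hβ.trans hδ⟩) ((hiff β (hβ.trans hδ)).2 hβ)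

end SepIDP

namespace SepIDP

/-! ### The maximal almost disjoint family -/

variable {χ : Cardinal.{u}} {C : Ordinal.{u} → Set Ordinal.{u}} {K : Ordinal.{u} → Set ZFSet.{u}}
  {A : Ordinal.{u} → Set ℕ} {δ β γ : Ordinal.{u}}

namespace IsTower

open IsSquareSeq (acc)

theorem countable_acc (hC : IsSquareSeq C) (hδ : δ < ω_ 2) (hδl : Order.IsSuccLimit δ)
    (hβ : β ∈ acc C δ) : (acc C β).Countable := by
  refine (hC.countable_of_mem_acc hδ hδl hβ).mono fun γ hγ => ?_
  rw [hC.eq_inter hδ hδl hβ]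
  exact ⟨hC.mem_of_mem_acc hδ hδl (hC.acc_subset_acc hδ hδl hβ hγ), hγ.1⟩

theorem inter_column_finite (h : IsTower χ C K A) (hC : IsSquareSeq C) (hδ : δ < ω_ 2)
    (hδl : Order.IsSuccLimit δ) (hβ : β ∈ acc C δ) (n : ℕ) : (A β ∩ column n).Finite :=
  (h β (hβ.1.trans hδ)).almostDisjoint (hC.countable_of_mem_acc hδ hδl hβ)
    (countable_acc hC hδ hδl hβ) _ (Or.inl ⟨n, rfl⟩)

theorem inter_finite (h : IsTower χ C K A) (hC : IsSquareSeq C) (hδ : δ < ω_ 2)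
    (hδl : Order.IsSuccLimit δ) (hβ : β ∈ acc C δ) (hγ : γ ∈ acc C δ) (hne : β ≠ γ) :
    (A β ∩ A γ).Finite := by
  have key : ∀ {β γ}, β ∈ acc C δ → γ ∈ acc C δ → γ < β → (A β ∩ A γ).Finite := by
    intro β γ hβ hγ hlt
    exact (h β (hβ.1.trans hδ)).almostDisjoint (hC.countable_of_mem_acc hδ hδl hβ)
      (countable_acc hC hδ hδl hβ) _
      (Or.inr ⟨⟨γ, hlt⟩, hC.mem_acc_of_lt hδ hδl hβ hγ hlt, rfl⟩)
  rcases hne.lt_or_gt with hlt | hlt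
  · rw [inter_comm]
    exact key hγ hβ hlt
  · exact key hβ hγ hlt

theorem base_subset (hC : IsSquareSeq C) (hδ : δ < ω_ 2)
    (hδl : Order.IsSuccLimit δ) (hβ : β ∈ acc C δ) :
    base C β (fun ξ => A ξ) ⊆ range column ∪ A '' acc C δ := by
  refine union_subset_union_right _ ?_
  rintro _ ⟨γ, hγ, rfl⟩
  exact ⟨γ, hC.acc_subset_acc hδ hδl hβ hγ, rfl⟩

/-- This is why `univ` is always a test set. It is positive because a column outside a finite part
of the base is almost disjoint from that part. -/
theorem infinite_of_mem_acc (h : IsTower χ C K A) (hC : IsSquareSeq C) (hδ : δ < ω_ 2)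
    (hδl : Order.IsSuccLimit δ) (hβ : β ∈ acc C δ) : (A β).Infinite := by
  rw [← inter_univ (A β)]
  refine (h β (hβ.1.trans hδ)).hitting (hC.countable_of_mem_acc hδ hδl hβ)
    (countable_acc hC hδ hδl hβ) _ (Or.inl rfl) fun G hG hGf => ?_
  obtain ⟨_, ⟨n, rfl⟩, hn⟩ :=
    (infinite_range_of_injective column_injective).exists_notMem_finite hGf
  refine (sdiff_sUnion_infinite (column_infinite n) hGf fun g hg => ?_).mono
    (sdiff_subset_sdiff_left (subset_univ _))
  rcases base_subset hC hδ hδl hβ (hG hg) with ⟨m, rfl⟩ | ⟨γ, hγ, rfl⟩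
  · rw [column_inter fun hmn : n = m => hn (by rw [hmn]; exact hg)]
    exact finite_empty
  · rw [inter_comm]
    exact h.inter_column_finite hC hδ hδl hγ n

/-- Only maximality is hard. The set that SEP gives in `M` need not belong to the tower, so it has
to be replaced by one from a model `K ζ` with `ζ < δ`, where the construction of the `A β` could
anticipate it. -/
theorem isMAD (h : IsTower χ C K A) (hC : IsSquareSeq C) {f : Set ℕ → Ordinal.{u}}
    (hf : ∀ s, f s < ω_ 2)
    (hfK : ∀ s t : Set ℕ, setCode t ∈ union K → t ⊆ s →
      ∃ c : Set ℕ, setCode c ∈ K (f s) ∧ t ⊆ c ∧ c ⊆ s)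
    {M : Set ZFSet.{u}} (hMs : LeSep ZFSet.omega ((ZFSet.omega.powerset : Set ZFSet.{u}) ∩ M))
    (hδ : δ < ω_ 2) (hδl : Order.IsSuccLimit δ)
    (hcof : ∀ X : Set Ordinal.{u}, X ⊆ Iio δ → X.Countable → ∃ b < δ, ∀ x ∈ X, x < b)
    (hfM : ∀ s, setCode s ∈ M → f s < δ)
    (hAM : ∀ β < δ, ∀ n : ℕ, setCode (A β \ Iio n) ∈ M) :
    IsMAD (range column ∪ A '' acc C δ) := by
  refine ⟨(infinite_range_of_injective column_injective).mono subset_union_left, ?_, ?_, ?_⟩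
  · rintro _ (⟨n, rfl⟩ | ⟨β, hβ, rfl⟩)
    · exact column_infinite n
    · exact h.infinite_of_mem_acc hC hδ hδl hβ
  · rintro _ (⟨n, rfl⟩ | ⟨β, hβ, rfl⟩) _ (⟨m, rfl⟩ | ⟨γ, hγ, rfl⟩) hne
    · rw [column_inter fun hmn : n = m => hne (congrArg column hmn)]
      exact finite_empty
    · rw [inter_comm]
      exact h.inter_column_finite hC hδ hδl hγ n
    · exact h.inter_column_finite hC hδ hδl hβ m
    · exact h.inter_finite hC hδ hδl hβ hγ fun hβγ => hne (hβγ ▸ rfl)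
  intro x hx
  by_contra! hcon
  replace hcon : ∀ a ∈ range column ∪ A '' acc C δ, (a ∩ x).Finite := fun a ha => by
    simpa using hcon a ha
  have hbd : ∀ β : acc C δ, ∃ n, A β \ Iio n ⊆ xᶜ := fun β => by
    obtain ⟨n, hn⟩ := (hcon (A β) (Or.inr ⟨β, β.2, rfl⟩)).bddAbove
    refine ⟨n + 1, fun m hm hmx => hm.2 ?_⟩
    exact Nat.lt_succ_of_le (hn ⟨hm.1, hmx⟩)
  choose n hn using hbd
  let t : acc C δ → Set ℕ := fun β => A β \ Iio (n β)
  have htinf : ∀ β, (t β).Infinite := fun β =>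
    (h.infinite_of_mem_acc hC hδ hδl β.2).sdiff (finite_Iio _)
  have htinj : Function.Injective t := by
    intro β γ hβγ
    by_contra hne
    have h1 := h.inter_finite hC hδ hδl β.2 γ.2 fun h' => hne (Subtype.ext h')
    refine htinf β (h1.subset fun m hm => ⟨hm.1, ?_⟩)
    rw [hβγ] at hm
    exact hm.1
  have hunc : ¬ (Set.univ : Set (acc C δ)).Countable := fun hc =>
    hC.acc_not_countable hδ hδl hcof (countable_univ_iff.1 hc).to_set
  -- First use of SEP, for `M`: `xᶜ` shrinks to `a ∈ M`, whose interpolation stage `f a` is below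
  -- `δ` by closure of `M`.
  obtain ⟨a, ⟨haP, haM⟩, hax, ha⟩ := hMs.2 (setCode xᶜ) (setCode_subset_omega _)
    (range fun β => setCode (t β)) (by
      rintro _ ⟨β, rfl⟩
      exact ⟨⟨setCode_mem_powerset _, hAM β β.2.1 _⟩, setCode_subset_iff.2 (hn β)⟩) (by
      intro hc
      rw [← image_univ] at hc
      exact hunc (countable_of_injective_of_countable_image
        (setCode_injective.comp htinj).injOn hc))
  obtain ⟨a, rfl⟩ := mem_powerset_omega_iff.1 haP
  rw [setCode_subset_iff] at hax
  have hL' : ¬ {β | t β ⊆ a}.Countable := by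
    refine fun hc => ha ((hc.image fun β => setCode (t β)).mono ?_)
    rintro _ ⟨⟨β, rfl⟩, hβ⟩
    exact ⟨β, setCode_subset_iff.1 hβ, rfl⟩
  have hζδ := hfM a haM
  have hζ := hf a
  have hc : ∀ β : {β | t β ⊆ a}, ∃ c : Set ℕ, setCode c ∈ K (f a) ∧ t β ⊆ c ∧ c ⊆ a :=
    fun β => hfK a (t β)
      (mem_union.2 ⟨β, β.1.2.1.trans hδ, (h β (β.1.2.1.trans hδ)).tail_mem _⟩) β.2
  choose c hcK htc hca using hc
  -- If there are only countably many interpolants, one of them contains uncountably many tails;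
  -- otherwise SEP for `K (f a)` is applied to the interpolants.
  obtain ⟨a', ha'K, ha'a, hL''⟩ : ∃ a' : Set ℕ, setCode a' ∈ K (f a) ∧ a' ⊆ a ∧
      ¬ {β | t β ⊆ a'}.Countable := by
    by_cases hct : (range fun β => setCode (c β)).Countable
    · by_contra! hall
      refine hL' ((hct.biUnion (t := fun z _ => {β | ∃ hβ : t β ⊆ a, setCode (c ⟨β, hβ⟩) = z})
        ?_).mono ?_)
      · rintro _ ⟨β, rfl⟩
        refine (hall (c β) (hcK β) (hca β)).mono ?_
        rintro γ ⟨hγ, hγβ⟩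
        rw [← setCode_injective hγβ]
        exact htc ⟨γ, hγ⟩
      · intro β hβ
        exact mem_iUnion₂.2 ⟨_, ⟨⟨β, hβ⟩, rfl⟩, hβ, rfl⟩
    · obtain ⟨a', ⟨ha'P, ha'K⟩, ha'a, ha'⟩ := (h _ hζ).sep.2 (setCode a)
        (setCode_subset_omega _) (range fun β => setCode (c β)) (by
          rintro _ ⟨β, rfl⟩
          exact ⟨⟨setCode_mem_powerset _, hcK β⟩, setCode_subset_iff.2 (hca β)⟩) hct
      obtain ⟨a', rfl⟩ := mem_powerset_omega_iff.1 ha'P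
      refine ⟨a', ha'K, setCode_subset_iff.1 ha'a, fun hco => ha' ?_⟩
      have hco' : {β : {β | t β ⊆ a} | t β ⊆ a'}.Countable :=
        hco.preimage Subtype.val_injective
      refine (hco'.image fun β => setCode (c β)).mono ?_
      rintro _ ⟨⟨β, rfl⟩, hβ⟩
      exact ⟨β, (htc β).trans (setCode_subset_iff.1 hβ), rfl⟩
  have hsK : setCode a'ᶜ ∈ K (f a) := by
    have := (h _ hζ).sep.1.compl_mem _ ⟨setCode_mem_powerset a', ha'K⟩
    rw [omega_sdiff_setCode] at this
    exact this.2
  -- The tests are read only from models indexed along the square sequence, so the stage is moved up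
  -- to a point of `C δ`.
  obtain ⟨ξ, hξC, hζξ⟩ := hC.unbounded δ hδ hδl _ hζδ
  have hξδ : ξ < δ := hC.subset δ hδ hδl hξC
  have hξ2 := hξδ.trans hδ
  obtain ⟨ν, hν, hνs⟩ := enumeration_spec (h ξ hξ2).good.2.1.le (h.mono hξ2 hζξ.le hsK)
  obtain ⟨_, ⟨β, hβa', rfl⟩, hξβ, hνβ⟩ := hC.exists_mem_gt_of_not_countable hδ hδl hcof hξδ hν
    (S := Subtype.val '' {β | t β ⊆ a'}) (by rintro _ ⟨β, -, rfl⟩; exact β.2)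
    fun hco => hL'' (countable_of_injective_of_countable_image Subtype.val_injective.injOn hco)
  -- By coherence `ξ ∈ C β`, and the order type of `C β` exceeds the index `ν` of `a'ᶜ`.
  have htest : a'ᶜ ∈ tests C β.1 fun ξ => K ξ := by
    refine Or.inr ⟨⟨ξ, hξβ⟩, ?_, ν, hνβ, hνs⟩
    rw [hC.eq_inter hδ hδl β.2]
    exact ⟨hξC, hξβ⟩
  by_cases hpos : ∀ G ⊆ base C β.1 (fun ξ => A ξ), G.Finite → (a'ᶜ \ ⋃₀ G).Infinite
  · refine (h β (β.2.1.trans hδ)).hitting (hC.countable_of_mem_acc hδ hδl β.2)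
      (countable_acc hC hδ hδl β.2) _ htest hpos ((finite_Iio (n β)).subset fun m hm => ?_)
    by_contra hmn
    exact hm.2 (hβa' ⟨hm.1, hmn⟩)
  -- If `a'ᶜ` is not positive, finitely many base sets cover it up to a finite set, hence also `x ⊆
  -- a'ᶜ`; but `x` is infinite and almost disjoint from each of them.
  · push Not at hpos
    obtain ⟨G, hG, hGf, hfin⟩ := hpos
    refine (sdiff_sUnion_infinite hx hGf fun g hg => ?_).mono (sdiff_subset_sdiff_left ?_)
      (by simpa using hfin)
    · rw [inter_comm]
      exact hcon g (base_subset hC hδ hδl β.2 (hG hg))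
    · exact fun m hm hma' => hax (ha'a hma') hm

end IsTower

theorem mk_range_column_union_le (hδ : δ < ω_ 2) :
    #(range column ∪ A '' IsSquareSeq.acc C δ : Set (Set ℕ)) ≤ ℵ_ 1 := by
  have h1 : (ℵ₀ : Cardinal.{0}) ≤ ℵ_ 1 := aleph0_le_aleph 1
  refine (mk_union_le _ _).trans (add_le_of_le h1 ?_ ?_)
  · exact (le_aleph0_iff_set_countable.2 (countable_range _)).trans h1
  · have h2 := mk_image_le_lift.{u + 1, 0} (f := A) (s := IsSquareSeq.acc C δ)
    have h3 : #(IsSquareSeq.acc C δ) ≤ ℵ_ 1 :=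
      (mk_le_mk_of_subset fun β hβ => hβ.1).trans (mk_Iio_le_aleph_one hδ)
    rw [← Cardinal.lift_le.{u + 1}, lift_aleph, Ordinal.lift_one]
    refine h2.trans ?_
    simpa using h3

theorem almostDisjointnessNumber_eq (hsq : SquareOmegaOne.{u})
    (hidp : AlephTwoIDP (ZFSet.omega.{u}.powerset) (inclusionRel ZFSet.omega.{u}.powerset))
    (hsep : SEPPowerset ZFSet.omega.{u}) : almostDisjointnessNumber = ℵ_ 1 := by
  obtain ⟨C, hC⟩ := hsq
  obtain ⟨χ₁, h₁⟩ := hidp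
  obtain ⟨χ₂, h₂⟩ := hsep
  -- The successor of `κ` is regular, beyond both thresholds, and large enough for `H χ` to contain
  -- `ω₂` and `𝒫(ω)`.
  let κ : Cardinal.{u} := max (max χ₁ χ₂) (max (ℵ_ 2) (2 ^ (ℵ₀ : Cardinal.{u})))
  have hκ : ℵ₀ ≤ κ := (aleph0_le_aleph 2).trans ((le_max_left _ _).trans (le_max_right _ _))
  have hκχ : κ < Order.succ κ := Order.lt_succ κ
  have hχ : (Order.succ κ).IsRegular := isRegular_succ hκ
  have hχ2 : ℵ_ 2 < Order.succ κ := ((le_max_left _ _).trans (le_max_right _ _)).trans_lt hκχ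
  have hχc : 2 ^ (ℵ₀ : Cardinal.{u}) < Order.succ κ :=
    ((le_max_right _ _).trans (le_max_right _ _)).trans_lt hκχ
  have hsep : SEPAt (Order.succ κ) :=
    h₂ _ (((le_max_right _ _).trans (le_max_left _ _)).trans hκχ.le) hχ
  obtain ⟨K, A, hT⟩ := exists_isTower C hsep hχ hχ2 hχc
  have hidp := h₁ _ (((le_max_left _ _).trans (le_max_left _ _)).trans hκχ.le) hχ
    (IsTower.union K) hT.isElemSubmodel_union hT.mk_union
    (IsTower.mem_union.2 ⟨0, omega_pos 2, (hT 0 (omega_pos 2)).pair_mem⟩)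
    hT.internallyCofinal_union
  choose f hf hfK using hT.exists_interpolation hidp
  obtain ⟨M, -, hMs, δ, hδ, hδl, hcof, hfM, hAM⟩ :=
    hsep.exists_closed_model A hχ hχ2 hχc f hf
  exact almostDisjointnessNumber_eq_of_exists
    (hT.isMAD hC hf hfK hMs hδ hδl hcof hfM hAM) (mk_range_column_union_le hδ)

end SepIDP

theorem corollary8p16 :
    ((2 : Cardinal.{u}) ^ (ℵ₀ : Cardinal.{u}) = ℵ_ 2 →
      SepIDP.AlephTwoIDP (ZFSet.omega.{u}.powerset)
        (SepIDP.inclusionRel ZFSet.omega.{u}.powerset)) ∧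
    (SepIDP.SquareOmegaOne.{u} →
      SepIDP.AlephTwoIDP (ZFSet.omega.{u}.powerset)
        (SepIDP.inclusionRel ZFSet.omega.{u}.powerset) →
      SepIDP.SEPPowerset ZFSet.omega.{u} →
      SepIDP.almostDisjointnessNumber = ℵ_ 1) :=
  ⟨SepIDP.alephTwoIDP_of_continuum_eq, SepIDP.almostDisjointnessNumber_eq⟩
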